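/- Let $d\ge 1$ and let $S\subset\mathbb{R}^d$ be compact, convex and of positive Lebesgue measure. Let $f$ be a probability density on $\mathbb{R}^d$ vanishing outside $S$, with $0<\inf_{x\in S}f(x)\le\sup_{x\in S}f(x)<\infty$. Let $s>d$ and $F(r)=r^{-s}$ for $r>0$. The geometric preferential attachment (GPA) graphs $G_n$ ($n\ge1$), with vertex set $\{0,1,\dots,n\}$, are built on independent random sites $X_0,X_1,\dots$ with density $f$ as follows. The graph $G_1$ is the single edge between $0$ and $1$. For $n\ge 1$, given $G_n$ and $X_0,\dots,X_n$, a vertex $n+1$ is added at the site $X_{n+1}$, which is independent of $(G_n,X_0,\dots,X_n)$, together with one edge from $n+1$ to a random vertex $v_{n+1}\in\{0,\dots,n\}$ such that $$\Pr[v_{n+1}=i\mid G_n,X_0,\dots,X_{n+1}]=\frac{\deg_n(i)\,F(\|X_i-X_{n+1}\|)}{\sum_{j=0}^n\deg_n(j)\,F(\|X_j-X_{n+1}\|)},\qquad 0\le i\le n,$$ where $\deg_n(i)$ is the degree of $i$ in $G_n$ regarded as an undirected graph. Let $N_n^{\mathrm{GPA}}(k)$ be the number of vertices of $G_n$ of degree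 at least $k$. Then for every $\gamma\in\left(0,\frac{s-d}{2s-d}\right)$ there is a constant $C<\infty$, depending only on $d,S,f,s,\gamma$, such that for all integers $k\ge 0$, $$\limsup_{n\to\infty}\,n^{-1}N_n^{\mathrm{GPA}}(k)\le C e^{-k^\gamma}\ \text{ a.s.},\qquad\text{and}\qquad \limsup_{n\to\infty}\,n^{-1}\,\mathbb{E}\big[N_n^{\mathrm{GPA}}(k)\big]\le C e^{-k^\gamma}.$$ -/

import Mathlib

open MeasureTheory ProbabilityTheory

/-- The edge set `E_n = {(1, v_1), …, (n, v_n)}` of the graph on the vertices `0, …, n` in which each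
vertex `j ≥ 1` is attached, on its arrival, to the vertex `v j`. -/
def attachEdges (v : ℕ → ℕ) (n : ℕ) : Finset (ℕ × ℕ) :=
  (Finset.Icc 1 n).image fun j => (j, v j)

/-- `deg_n(i)`: the number of edges of `E_n` incident to `i` (as an undirected graph). -/
def attachDeg (v : ℕ → ℕ) (n i : ℕ) : ℕ :=
  ((attachEdges v n).filter fun e => e.1 = i ∨ e.2 = i).card

/-- `N_n(k)`: the number of vertices among `0, …, n` with degree at least `k`. -/
def numDegGE (v : ℕ → ℕ) (n k : ℕ) : ℕ :=
  ((Finset.range (n + 1)).filter fun i => k ≤ attachDeg v n i).card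

/-- The normalisation `D_n(y) = ∑_{i ≤ n} deg_n(i) F(ρ(x_i, y))` of the attachment rule. -/
noncomputable def attachTotal {d : ℕ} (F : ℝ → ℝ) (x : ℕ → EuclideanSpace ℝ (Fin d)) (v : ℕ → ℕ)
    (n : ℕ) (y : EuclideanSpace ℝ (Fin d)) : ℝ :=
  ∑ i ∈ Finset.range (n + 1), (attachDeg v n i : ℝ) * F (dist (x i) y)

/-- The attachment probability `deg_n(i) F(ρ(x_i, x_{n+1})) / D_n(x_{n+1})`. -/
noncomputable def attachProb {d : ℕ} (F : ℝ → ℝ) (x : ℕ → EuclideanSpace ℝ (Fin d)) (v : ℕ → ℕ)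
    (n i : ℕ) : ℝ :=
  (attachDeg v n i : ℝ) * F (dist (x i) (x (n + 1))) / attachTotal F x v n (x (n + 1))

/-- The σ-algebra generated by the sites `X_0, …, X_n` and the choices `v_1, …, v_n`, that is,
by the graph `G_n` and the sites of its vertices. -/
abbrev gpaHistory {Ω : Type*} {d : ℕ} (X : ℕ → Ω → EuclideanSpace ℝ (Fin d)) (v : ℕ → Ω → ℕ)
    (n : ℕ) : MeasurableSpace Ω :=
  (⨆ i ∈ Finset.range (n + 1), MeasurableSpace.comap (X i) inferInstance) ⊔
    (⨆ j ∈ Finset.Icc 1 n, MeasurableSpace.comap (v j) inferInstance)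

/-- `X` (sites) and `v` (attachment choices; the value of `v 0` is not used) form a geometric
preferential attachment graph process with site density `f` and attractiveness function `F`. -/
structure IsGPA {Ω : Type*} [MeasurableSpace Ω] (μ : Measure Ω) {d : ℕ}
    (f : EuclideanSpace ℝ (Fin d) → ℝ) (F : ℝ → ℝ)
    (X : ℕ → Ω → EuclideanSpace ℝ (Fin d)) (v : ℕ → Ω → ℕ) : Prop where
  measurable_site : ∀ n, Measurable (X n)
  measurable_choice : ∀ n, 1 ≤ n → Measurable (v n)
  /-- Each site has density `f`. -/
  law_site : ∀ n, μ.map (X n) = volume.withDensity fun x => ENNReal.ofReal (f x)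
  /-- The sites are independent. -/
  indep_site : iIndepFun X μ
  /-- The site of a new vertex is independent of the graph built so far and its sites. -/
  indep_history : ∀ n,
    Indep (gpaHistory X v n) (MeasurableSpace.comap (X (n + 1)) inferInstance) μ
  /-- The initial graph is the single edge `(1, 0)`. -/
  choice_one : ∀ ω, v 1 ω = 0
  /-- A new vertex is attached to one of the existing vertices. -/
  choice_le : ∀ n, 1 ≤ n → ∀ ω, v (n + 1) ω ≤ n
  /-- The attachment rule: the conditional probability that `v_{n+1} = i`, given `G_n` and the sites
  `X_0, …, X_{n+1}`. -/
  rule : ∀ n, 1 ≤ n → ∀ i ≤ n,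
    μ[({ω | v (n + 1) ω = i}).indicator (fun _ => (1 : ℝ)) |
        gpaHistory X v n ⊔ MeasurableSpace.comap (X (n + 1)) inferInstance]
      =ᵐ[μ] fun ω => attachProb F (fun m => X m ω) (fun m => v m ω) n i

/-! ### Deterministic bounds on degrees and their exponential potential -/

section Graph

variable {v : ℕ → ℕ}

/-! Fix a large `k`, put t = k^γ and ε = e^(-t), and disregard the first a ≈ εn vertices. Call the
arrival m+1 good if at least t earlier vertices lie within distance δ_m of it, where δ_m^d is of
order t/m. By convexity of `S` a ball of radius δ_m about a point of `S` has mass at least 4t/m for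
a suitable constant in δ_m, so about 4t such neighbours are expected, and a Chernoff bound limits
the frequency of bad arrivals to about ε. At a good arrival the normalisation is at least t
δ_m^(-s), because every degree is at least 1. Hence a vertex of degree below `k` at distance r is
chosen with probability at most min(1, (R/r)^s), where R = δ_m (k/t)^(1/s). As s > d, this kernel
has mass O(R^d), so such a vertex attracts good arrivals at rate at most M/m, with M of order t
(k/t)^(d/s).

Consequently the potential ∑ 2^`goodDeg` over the later vertices has drift at most 1 +
(M/m)·potential, and mean at most n (n/a)^M ≤ n e^(Mt). A vertex of degree at least `k` is early, or
is chosen by a bad arrival, or has `goodDeg` at least k - 1; the last kind contributes 2^(k-1) each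
to the potential, so there are about εn of them at most once (M + 1) t ≤ (k - 1) log 2. Since Mt is
of order k^(2γ + (1-γ)d/s), this holds for large `k` exactly because γ < (s-d)/(2s-d).

These mean bounds are made pathwise by one elementary fact, `integral_posPart_sq_le`: a
supermartingale with bounded increments rises above its start by only O(√n) in mean square. It is
applied to the averaged neighbour potential, to the compensated count of bad arrivals and to the
discounted degree potential. The outcome, `exists_remainder`, is N_n(k) ≤ 4εn + √T with E T = O(n).
The bound in mean follows by linearising the root; the almost sure bound follows from Markov and
Borel–Cantelli along powers of two, together with monotonicity of N_n(k) in n. The finitely many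
small `k` are absorbed into the constant. -/

theorem attachDeg_eq_sum (v : ℕ → ℕ) (n i : ℕ) :
    attachDeg v n i = ∑ j ∈ Finset.Icc 1 n, if j = i ∨ v j = i then 1 else 0 := by
  classical
  unfold attachDeg attachEdges
  rw [Finset.filter_image, Finset.card_image_of_injective _ (fun a b h => (Prod.mk.inj h).1),
    Finset.card_filter]

theorem attachDeg_succ (v : ℕ → ℕ) (n i : ℕ) :
    attachDeg v (n + 1) i = attachDeg v n i + if n + 1 = i ∨ v (n + 1) = i then 1 else 0 := by
  rw [attachDeg_eq_sum, attachDeg_eq_sum, Finset.sum_Icc_succ_top (by omega)]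

theorem attachDeg_mono (v : ℕ → ℕ) (i : ℕ) : Monotone fun n => attachDeg v n i :=
  monotone_nat_of_le_succ fun n => by rw [attachDeg_succ]; omega

theorem one_le_attachDeg (h1 : v 1 = 0) {n i : ℕ} (hn : 1 ≤ n) (hi : i ≤ n) :
    1 ≤ attachDeg v n i := by
  rcases Nat.eq_zero_or_pos i with rfl | hpos
  · refine le_trans ?_ (attachDeg_mono v 0 hn)
    show 1 ≤ attachDeg v 1 0
    rw [attachDeg_eq_sum, Finset.Icc_self, Finset.sum_singleton]
    simp [h1]
  · refine le_trans ?_ (attachDeg_mono v i hi)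
    obtain ⟨j, rfl⟩ : ∃ j, i = j + 1 := ⟨i - 1, by omega⟩
    simp [attachDeg_succ]

theorem attachDeg_eq_zero (hv : ∀ j, 1 ≤ j → v j < j) {n i : ℕ} (hi : n < i) :
    attachDeg v n i = 0 := by
  rw [attachDeg_eq_sum]
  refine Finset.sum_eq_zero fun j hj => ?_
  rw [Finset.mem_Icc] at hj
  have := hv j hj.1
  rw [if_neg]; omega

theorem attachDeg_self (hv : ∀ j, 1 ≤ j → v j < j) {i : ℕ} (hi : 1 ≤ i) :
    attachDeg v i i = 1 := by
  obtain ⟨j, rfl⟩ : ∃ j, i = j + 1 := ⟨i - 1, by omega⟩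
  simp [attachDeg_succ, attachDeg_eq_zero hv (Nat.lt_succ_self j)]

theorem numDegGE_mono (v : ℕ → ℕ) (k : ℕ) : Monotone fun n => numDegGE v n k := by
  intro m n hmn
  refine Finset.card_le_card fun i hi => ?_
  simp only [Finset.mem_filter, Finset.mem_range] at hi ⊢
  exact ⟨by omega, hi.2.trans (attachDeg_mono v i hmn)⟩

theorem numDegGE_le (v : ℕ → ℕ) (n k : ℕ) : numDegGE v n k ≤ n + 1 :=
  (Finset.card_filter_le _ _).trans (by simp)

open Classical in
/-- The number of good arrivals up to time `m` that attach to `i` while `i` has degree below `k`. -/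
noncomputable def goodDeg (v : ℕ → ℕ) (G : ℕ → Prop) (k i m : ℕ) : ℕ :=
  ∑ j ∈ Finset.Ioc i m, if v j = i ∧ G j ∧ attachDeg v (j - 1) i < k then 1 else 0

open Classical in
/-- The number of arrivals in `(a, m]` that are not good. -/
noncomputable def badCount (G : ℕ → Prop) (a m : ℕ) : ℕ :=
  ∑ j ∈ Finset.Ioc a m, if G j then 0 else 1

variable {G : ℕ → Prop} {k : ℕ}

theorem goodDeg_self (v : ℕ → ℕ) (G : ℕ → Prop) (k i : ℕ) : goodDeg v G k i i = 0 := by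
  simp [goodDeg]

open Classical in
theorem goodDeg_succ (v : ℕ → ℕ) (G : ℕ → Prop) (k : ℕ) {i m : ℕ} (h : i ≤ m) :
    goodDeg v G k i (m + 1) = goodDeg v G k i m +
      if v (m + 1) = i ∧ G (m + 1) ∧ attachDeg v m i < k then 1 else 0 := by
  unfold goodDeg
  rw [Finset.sum_Ioc_succ_top h]
  rfl

open Classical in
theorem badCount_succ (G : ℕ → Prop) {a m : ℕ} (h : a ≤ m) :
    badCount G a (m + 1) = badCount G a m + if G (m + 1) then 0 else 1 := by
  unfold badCount
  rw [Finset.sum_Ioc_succ_top h]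

/-- Every counted arrival raises the degree, and counting stops once the degree reaches `k`; this
truncation keeps the potential bounded. -/
theorem goodDeg_le {i m : ℕ} (h : i ≤ m) :
    goodDeg v G k i m ≤ attachDeg v m i ∧ goodDeg v G k i m ≤ k := by
  induction m, h using Nat.le_induction with
  | base => simp [goodDeg_self]
  | succ m hm ih =>
    rw [goodDeg_succ v G k hm, attachDeg_succ]
    split_ifs with h1 h2 <;> omega

open Classical in
-- Until the degree of `i` reaches `k`, each new edge at `i` is recorded as good or as bad; the 1 is
-- the edge with which `i` itself arrives.
theorem min_attachDeg_le (hv : ∀ j, 1 ≤ j → v j < j) {i m : ℕ} (hi : 1 ≤ i) (h : i ≤ m) :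
    min (attachDeg v m i) k ≤ 1 + goodDeg v G k i m +
      ∑ j ∈ Finset.Ioc i m, if v j = i ∧ ¬ G j then 1 else 0 := by
  induction m, h using Nat.le_induction with
  | base => rw [attachDeg_self hv hi]; omega
  | succ m hm ih =>
    rw [goodDeg_succ v G k hm, attachDeg_succ, Finset.sum_Ioc_succ_top hm]
    by_cases h1 : v (m + 1) = i <;> by_cases h2 : G (m + 1) <;>
      by_cases h3 : attachDeg v m i < k <;>
      simp [h1, h2, h3, show ¬ (m + 1 = i) by omega] at ih ⊢ <;> omega

open Classical in
-- A late vertex of high degree that no bad arrival chose must owe at least k - 1 edges to good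
-- ones. The vertices chosen by bad arrivals are the image under `v` of those arrivals, hence no
-- more numerous.
theorem numDegGE_le_add (hv : ∀ j, 1 ≤ j → v j < j) {a n : ℕ} (G : ℕ → Prop) (hk : 1 ≤ k) :
    numDegGE v n k ≤ (a + 1) + badCount G a n +
      ((Finset.Ioc a n).filter fun i => k - 1 ≤ goodDeg v G k i n).card := by
  have hsub : ((Finset.range (n + 1)).filter fun i => k ≤ attachDeg v n i) ⊆
      Finset.range (a + 1) ∪ (((Finset.Ioc a n).filter fun j => ¬ G j).image v) ∪
      ((Finset.Ioc a n).filter fun i => k - 1 ≤ goodDeg v G k i n) := by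
    intro i hi
    simp only [Finset.mem_filter, Finset.mem_range, Finset.mem_union, Finset.mem_image,
      Finset.mem_Ioc] at hi ⊢
    by_cases hia : i < a + 1
    · exact Or.inl (Or.inl hia)
    by_cases hg : k - 1 ≤ goodDeg v G k i n
    · exact Or.inr ⟨by omega, hg⟩
    have h := min_attachDeg_le (G := G) (k := k) hv (i := i) (m := n) (by omega) (by omega)
    have hne : (∑ j ∈ Finset.Ioc i n, if v j = i ∧ ¬ G j then 1 else 0) ≠ 0 := by
      intro h0
      rw [h0] at h
      omega
    obtain ⟨j, hj, hj'⟩ := Finset.exists_ne_zero_of_sum_ne_zero hne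
    rw [Finset.mem_Ioc] at hj
    have hj2 : v j = i ∧ ¬ G j := by
      by_contra hc
      exact hj' (if_neg hc)
    exact Or.inl (Or.inr ⟨j, ⟨⟨by omega, hj.2⟩, hj2.2⟩, hj2.1⟩)
  refine (Finset.card_le_card hsub).trans ((Finset.card_union_le _ _).trans ?_)
  refine Nat.add_le_add_right ((Finset.card_union_le _ _).trans ?_) _
  rw [Finset.card_range]
  refine Nat.add_le_add_left (Finset.card_image_le.trans (le_of_eq ?_)) _
  rw [Finset.card_filter, badCount]
  exact Finset.sum_congr rfl fun j _ => by by_cases h : G j <;> simp [h]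

/-- The potential `∑_{a < i ≤ m} 2 ^ goodDeg i`. -/
noncomputable def goodPot (v : ℕ → ℕ) (G : ℕ → Prop) (k a m : ℕ) : ℝ :=
  ∑ i ∈ Finset.Ioc a m, (2 : ℝ) ^ goodDeg v G k i m

open Classical in
theorem card_goodDeg_le (a n : ℕ) :
    (((Finset.Ioc a n).filter fun i => k - 1 ≤ goodDeg v G k i n).card : ℝ) * 2 ^ (k - 1) ≤
      goodPot v G k a n := by
  unfold goodPot
  rw [← nsmul_eq_mul]
  refine (Finset.card_nsmul_le_sum _ (fun i => (2 : ℝ) ^ goodDeg v G k i n) _ fun i hi => ?_).trans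
    (Finset.sum_le_sum_of_subset_of_nonneg (Finset.filter_subset _ _) fun i _ _ => by positivity)
  exact pow_le_pow_right₀ one_le_two (Finset.mem_filter.mp hi).2

open Classical in
-- The newcomer enters with 2^0, and a counted attachment doubles the summand of its target, i.e.
-- adds that summand once more.
theorem goodPot_succ (v : ℕ → ℕ) (G : ℕ → Prop) (k : ℕ) {a m : ℕ} (h : a ≤ m) :
    goodPot v G k a (m + 1) = goodPot v G k a m + 1 + ∑ i ∈ Finset.Ioc a m,
      2 ^ goodDeg v G k i m *
        if v (m + 1) = i ∧ G (m + 1) ∧ attachDeg v m i < k then 1 else 0 := by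
  unfold goodPot
  rw [Finset.sum_Ioc_succ_top h, goodDeg_self, pow_zero, add_right_comm, ← Finset.sum_add_distrib]
  congr 1
  refine Finset.sum_congr rfl fun i hi => ?_
  rw [goodDeg_succ v G k (Finset.mem_Ioc.mp hi).2]
  split_ifs
  · rw [pow_succ]; ring
  · simp

theorem goodPot_nonneg (a m : ℕ) : 0 ≤ goodPot v G k a m :=
  Finset.sum_nonneg fun i _ => by positivity

theorem goodPot_le (a m : ℕ) : goodPot v G k a m ≤ m * 2 ^ k := by
  unfold goodPot
  refine (Finset.sum_le_card_nsmul _ _ ((2 : ℝ) ^ k) fun i hi =>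
    pow_le_pow_right₀ one_le_two (goodDeg_le (Finset.mem_Ioc.mp hi).2).2).trans ?_
  rw [nsmul_eq_mul]
  gcongr
  simp

/-- An arrival chooses only one vertex, so at most one summand doubles. -/
theorem goodPot_succ_le {a m : ℕ} (h : a ≤ m) :
    goodPot v G k a (m + 1) ≤ goodPot v G k a m + 1 + 2 ^ k := by
  classical
  rw [goodPot_succ v G k h]
  gcongr
  calc _ ≤ ∑ i ∈ Finset.Ioc a m, if v (m + 1) = i then (2 : ℝ) ^ k else 0 := by
        refine Finset.sum_le_sum fun i hi => ?_
        by_cases h1 : v (m + 1) = i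
        · rw [if_pos h1]
          have h2 := pow_le_pow_right₀ (one_le_two (α := ℝ))
            (goodDeg_le (v := v) (G := G) (k := k) (Finset.mem_Ioc.mp hi).2).2
          split_ifs
          · simpa using h2
          · simp
        · simp [h1]
    _ ≤ 2 ^ k := by
        rw [Finset.sum_ite_eq]
        split_ifs
        · exact le_rfl
        · positivity

end Graph

/-! ### Second moments of supermartingales and integrating out an independent variable -/

section Probability

/-- A supermartingale with increments bounded by `K`, started at `0`, has positive part with second
moment at most `K ^ 2` times the number of steps. -/
theorem integral_posPart_sq_le {Ω : Type*} [MeasurableSpace Ω] {μ : Measure Ω}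
    [IsProbabilityMeasure μ] (Z : ℕ → Ω → ℝ) (K : ℝ) {a n : ℕ} (han : a ≤ n)
    (hZm : ∀ m, a ≤ m → m ≤ n → Measurable (Z m)) (h0 : ∀ ω, Z a ω = 0)
    (hK : ∀ m, a ≤ m → m < n → ∀ ω, |Z (m + 1) ω - Z m ω| ≤ K)
    (hdrift : ∀ m, a ≤ m → m < n → ∫ ω, max (Z m ω) 0 * (Z (m + 1) ω - Z m ω) ∂μ ≤ 0) :
    Integrable (fun ω => (max (Z n ω) 0) ^ 2) μ ∧
      ∫ ω, (max (Z n ω) 0) ^ 2 ∂μ ≤ (n - a) * K ^ 2 := by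
  -- This crude linear bound serves integrability only.
  have hbd : ∀ m, a ≤ m → m ≤ n → ∀ ω, |Z m ω| ≤ (m - a) * K := by
    intro m hm
    induction m, hm using Nat.le_induction with
    | base => intro _ ω; simp [h0]
    | succ m hm ih =>
      intro hmn ω
      have h1 := ih (by omega) ω
      have h2 := hK m hm (by omega) ω
      have h3 := abs_add_le (Z m ω) (Z (m + 1) ω - Z m ω)
      rw [add_sub_cancel] at h3
      push_cast
      linarith
  have hmax : ∀ m, a ≤ m → m ≤ n → ∀ ω, max (Z m ω) 0 ≤ (m - a) * K := fun m hm hmn ω =>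
    max_le ((le_abs_self _).trans (hbd m hm hmn ω)) ((abs_nonneg _).trans (hbd m hm hmn ω))
  have hint : ∀ m, a ≤ m → m ≤ n → Integrable (fun ω => (max (Z m ω) 0) ^ 2) μ := by
    intro m hm hmn
    have m1 := hZm m hm hmn
    refine Integrable.of_bound (by fun_prop) (((m - a) * K) ^ 2) (ae_of_all _ fun ω => ?_)
    rw [Real.norm_eq_abs, abs_of_nonneg (by positivity)]
    exact pow_le_pow_left₀ (le_max_right _ _) (hmax m hm hmn ω) 2
  have key : ∀ m, a ≤ m → m ≤ n → ∫ ω, (max (Z m ω) 0) ^ 2 ∂μ ≤ (m - a) * K ^ 2 := by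
    intro m hm
    induction m, hm using Nat.le_induction with
    | base => intro _; simp [h0]
    | succ m hm ih =>
      intro hmn
      have h1 := ih (by omega)
      have h2 := hdrift m hm (by omega)
      have m1 := hZm m hm (by omega)
      have m2 := hZm (m + 1) (by omega) hmn
      have b2 := hK m hm (by omega)
      have hmax := hmax m hm (by omega)
      have i1 := hint m hm (by omega)
      have i2 : Integrable (fun ω => max (Z m ω) 0 * (Z (m + 1) ω - Z m ω)) μ :=
        Integrable.of_bound (by fun_prop) (((m - a) * K) * K) (ae_of_all _ fun ω => by
          rw [Real.norm_eq_abs, abs_mul, abs_of_nonneg (le_max_right (Z m ω) 0)]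
          exact mul_le_mul (hmax ω) (b2 ω) (abs_nonneg _) ((le_max_right _ _).trans (hmax ω)))
      -- If Z_m is positive, expand the square; otherwise the new positive part is at most the
      -- increment in absolute value.
      have hle : ∀ ω, (max (Z (m + 1) ω) 0) ^ 2 ≤
          ((max (Z m ω) 0) ^ 2 + 2 * (max (Z m ω) 0 * (Z (m + 1) ω - Z m ω))) + K ^ 2 := by
        intro ω
        have h3 := abs_le.mp (b2 ω)
        rcases max_cases (Z m ω) 0 with ⟨e1, c1⟩ | ⟨e1, c1⟩ <;>
          rcases max_cases (Z (m + 1) ω) 0 with ⟨e2, c2⟩ | ⟨e2, c2⟩ <;> rw [e1, e2] <;>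
          nlinarith
      have i3 : Integrable (fun ω => (max (Z m ω) 0) ^ 2 +
          2 * (max (Z m ω) 0 * (Z (m + 1) ω - Z m ω))) μ := i1.add (i2.const_mul 2)
      calc _ ≤ ∫ ω, (((max (Z m ω) 0) ^ 2 + 2 * (max (Z m ω) 0 * (Z (m + 1) ω - Z m ω)))
              + K ^ 2) ∂μ :=
            integral_mono_of_nonneg (ae_of_all _ fun ω => by positivity)
              (i3.add (integrable_const _)) (ae_of_all _ hle)
        _ = (∫ ω, (max (Z m ω) 0) ^ 2 ∂μ) +
              2 * (∫ ω, max (Z m ω) 0 * (Z (m + 1) ω - Z m ω) ∂μ) + K ^ 2 := by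
            rw [integral_add i3 (integrable_const _), integral_add i1 (i2.const_mul 2),
              integral_const_mul]
            simp
        _ ≤ _ := by push_cast; linarith
  exact ⟨hint n han le_rfl, key n han le_rfl⟩

/-- A variable independent of `H` can be integrated out first. -/
theorem integral_freeze_of_indepFun {Ω T E : Type*} [MeasurableSpace Ω] [MeasurableSpace T]
    [MeasurableSpace E] {μ : Measure Ω} [IsProbabilityMeasure μ] {H : Ω → T} {X : Ω → E}
    (hH : Measurable H) (hX : Measurable X) (hind : IndepFun H X μ)
    {g : T → E → ℝ} (hg : Measurable (Function.uncurry g)) {K : ℝ} (hK : ∀ ω y, |g ω y| ≤ K) :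
    ∫ ω, g (H ω) (X ω) ∂μ = ∫ ω, ∫ y, g (H ω) y ∂(μ.map X) ∂μ := by
  have := Measure.isProbabilityMeasure_map (μ := μ) hX.aemeasurable
  have := Measure.isProbabilityMeasure_map (μ := μ) hH.aemeasurable
  have hp := (indepFun_iff_map_prod_eq_prod_map_map hH.aemeasurable hX.aemeasurable).mp hind
  have h1 : ∫ ω, g (H ω) (X ω) ∂μ =
      ∫ z, Function.uncurry g z ∂(μ.map fun ω => (H ω, X ω)) := by
    rw [integral_map (hH.prodMk hX).aemeasurable hg.aestronglyMeasurable]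
    rfl
  rw [h1, hp, integral_prod _ (Integrable.of_bound hg.aestronglyMeasurable K
    (ae_of_all _ fun z => hK z.1 z.2)), integral_map hH.aemeasurable]
  · rfl
  · exact hg.stronglyMeasurable.integral_prod_right.aestronglyMeasurable

/-- A variable independent of the σ-algebra `m` can be integrated out first. -/
theorem integral_freeze {Ω E : Type*} {m mΩ : MeasurableSpace Ω} [mE : MeasurableSpace E]
    {μ : Measure Ω} [IsProbabilityMeasure μ] (hm : m ≤ mΩ) {X : Ω → E}
    (hX : Measurable X) (hind : Indep m (MeasurableSpace.comap X inferInstance) μ)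
    {g : Ω → E → ℝ} (hg : Measurable[m.prod mE] (Function.uncurry g)) {K : ℝ}
    (hK : ∀ ω y, |g ω y| ≤ K) :
    ∫ ω, g ω (X ω) ∂μ = ∫ ω, ∫ y, g ω y ∂(μ.map X) ∂μ := by
  -- The frozen variable is the identity, from Ω with its full σ-algebra to Ω with `m`.
  refine @integral_freeze_of_indepFun Ω Ω E mΩ m mE μ _ id X (measurable_id'' hm) hX ?_ g hg K hK
  refine (@IndepFun_iff_Indep Ω Ω E mΩ m mE id X μ).mpr ?_
  rwa [MeasurableSpace.comap_id]

end Probability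

/-! ### Upper and lower mass estimates for the site density -/

section Density

variable {d : ℕ}

/-- The ball of radius `δ` about `y` with its centre removed, as a relation. -/
def Near {E : Type*} [PseudoMetricSpace E] (δ : ℝ) (x y : E) : Prop := 0 < dist x y ∧ dist x y ≤ δ

/-- Replaces the truncated kernel by a rescaled (1 + ‖z‖)^(-s), which is integrable for s > d. -/
theorem min_one_rpow_le {R r s : ℝ} (hR : 0 < R) (hr : 0 ≤ r) (hs : 0 < s) :
    min 1 ((R / r) ^ s) ≤ 2 ^ s * (1 + R⁻¹ * r) ^ (-s) := by
  have h1 : 0 < 1 + R⁻¹ * r := by positivity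
  rw [Real.rpow_neg h1.le, ← div_eq_mul_inv, ← Real.div_rpow (by norm_num) h1.le]
  rcases le_total r R with h | h
  · refine (min_le_left _ _).trans (Real.one_le_rpow ?_ hs.le)
    rw [le_div_iff₀ h1]
    have : R⁻¹ * r ≤ 1 := by rw [inv_mul_le_iff₀ hR]; linarith
    linarith
  · refine (min_le_right _ _).trans (Real.rpow_le_rpow (by positivity) ?_ hs.le)
    have hr' : 0 < r := hR.trans_le h
    rw [div_le_div_iff₀ hr' h1]
    have : R * (R⁻¹ * r) = r := by field_simp
    nlinarith

/-- The truncated power kernel at scale `R` has mass of order `R ^ d`. -/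
theorem exists_integral_min_rpow_le (d : ℕ) {f : EuclideanSpace ℝ (Fin d) → ℝ} (hfmeas : Measurable f)
    {b : ℝ} (hf0 : ∀ x, 0 ≤ f x) (hfb : ∀ x, f x ≤ b) {s : ℝ} (hs : (d : ℝ) < s) :
    ∃ C : ℝ, 0 < C ∧ ∀ (x : EuclideanSpace ℝ (Fin d)) (R : ℝ), 0 < R →
      ∫ y, min 1 ((R / dist x y) ^ s) ∂(volume.withDensity fun x => ENNReal.ofReal (f x)) ≤
        C * R ^ d := by
  have hs0 : 0 < s := lt_of_le_of_lt (Nat.cast_nonneg d) hs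
  have hI : Integrable (fun z : EuclideanSpace ℝ (Fin d) => (1 + ‖z‖) ^ (-s)) volume :=
    integrable_one_add_norm (by simpa using hs)
  set I := ∫ z : EuclideanSpace ℝ (Fin d), (1 + ‖z‖) ^ (-s) with hIdef
  have hI0 : 0 ≤ I := integral_nonneg fun z => by positivity
  have hb : 0 ≤ b := (hf0 0).trans (hfb 0)
  -- The summand 1 only makes the constant strictly positive.
  refine ⟨b * 2 ^ s * I + 1, by positivity, fun x R hR => ?_⟩
  rw [integral_withDensity_eq_integral_toReal_smul (by fun_prop) (by simp)]
  have hscale : Integrable (fun z : EuclideanSpace ℝ (Fin d) => (1 + ‖R⁻¹ • z‖) ^ (-s)) volume :=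
    hI.comp_smul (inv_ne_zero hR.ne')
  have hsub := hscale.comp_sub_right x
  calc _ ≤ ∫ y, (b * 2 ^ s) * (1 + ‖R⁻¹ • (y - x)‖) ^ (-s) := by
        refine integral_mono_of_nonneg (ae_of_all _ fun y => ?_) (hsub.const_mul _)
          (ae_of_all _ fun y => ?_)
        · simp only [smul_eq_mul, Pi.zero_apply]; positivity
        · simp only [smul_eq_mul]
          rw [ENNReal.toReal_ofReal (hf0 y), norm_smul, Real.norm_of_nonneg (by positivity),
            ← dist_eq_norm, dist_comm y x, mul_assoc]
          exact mul_le_mul (hfb y) (min_one_rpow_le hR dist_nonneg hs0) (by positivity) hb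
    _ = b * 2 ^ s * I * R ^ d := by
        rw [integral_const_mul,
          integral_sub_right_eq_self (fun z : EuclideanSpace ℝ (Fin d) => (1 + ‖R⁻¹ • z‖) ^ (-s)) x,
          Measure.integral_comp_inv_smul volume
            (fun z : EuclideanSpace ℝ (Fin d) => (1 + ‖z‖) ^ (-s)) R, finrank_euclideanSpace_fin,
          abs_of_pos (by positivity), smul_eq_mul, ← hIdef]
        ring
    _ ≤ _ := by
        have : 0 ≤ R ^ d := by positivity
        nlinarith

/-- A density bounded below on a convex body gives every small ball about a point of the body mass
of order at least `r ^ d`. -/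
theorem exists_le_measure_near (d : ℕ) (hd : 1 ≤ d) {S : Set (EuclideanSpace ℝ (Fin d))}
    (hScompact : IsCompact S) (hSconvex : Convex ℝ S) (hSvol : 0 < volume S)
    {f : EuclideanSpace ℝ (Fin d) → ℝ}
    {a : ℝ} (ha : 0 < a) (hfa : ∀ x ∈ S, a ≤ f x)
    [IsFiniteMeasure (volume.withDensity fun x => ENNReal.ofReal (f x))] :
    ∃ c r₀ : ℝ, 0 < c ∧ 0 < r₀ ∧ ∀ y ∈ S, ∀ r : ℝ, 0 < r → r ≤ r₀ →
      c * r ^ d ≤ (volume.withDensity fun x => ENNReal.ofReal (f x)).real {x | Near r x y} := by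
  obtain ⟨D, hD0, hD⟩ : ∃ D : ℝ, 0 < D ∧ ∀ x ∈ S, ∀ y ∈ S, dist x y ≤ D := by
    obtain ⟨D, hD⟩ := (Metric.isBounded_iff).mp hScompact.isBounded
    exact ⟨max D 1, by positivity, fun x hx y hy => (hD hx hy).trans (le_max_left _ _)⟩
  have hfin : volume S ≠ ⊤ := hScompact.measure_lt_top.ne
  have hV : 0 < (volume S).toReal := ENNReal.toReal_pos hSvol.ne' hfin
  refine ⟨a * (volume S).toReal / D ^ d, D, by positivity, hD0, fun y hy r hr hrD => ?_⟩
  set ν := volume.withDensity fun x => ENNReal.ofReal (f x) with hν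
  -- Contracting `S` towards `y` by r/D, with `D` bounding the diameter, gives a set that convexity
  -- keeps inside `S`, within distance r of `y`, of volume (r/D)^d times that of `S`.
  set T := AffineMap.homothety y (r / D) '' S with hT
  have hq : r / D ≤ 1 := (div_le_one hD0).mpr hrD
  have hq0 : 0 < r / D := by positivity
  have hTS : T ⊆ S := by
    rintro _ ⟨x, hx, rfl⟩
    rw [AffineMap.homothety_eq_lineMap]
    exact hSconvex.lineMap_mem hy hx ⟨hq0.le, hq⟩
  have hTm : MeasurableSet T := by
    refine IsCompact.measurableSet (hScompact.image ?_)
    exact AffineMap.homothety_continuous y _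
  have hTn : T \ {y} ⊆ {x | Near r x y} := by
    rintro _ ⟨⟨x, hx, rfl⟩, hne⟩
    refine ⟨dist_pos.mpr hne, ?_⟩
    rw [AffineMap.homothety_eq_lineMap, dist_lineMap_left, Real.norm_of_nonneg hq0.le]
    calc r / D * dist y x ≤ r / D * D := by gcongr; exact hD y hy x hx
      _ = r := by field_simp
  -- In positive dimension points are null, so removing the centre costs nothing.
  have : Nonempty (Fin d) := ⟨⟨0, hd⟩⟩
  have : Nontrivial (EuclideanSpace ℝ (Fin d)) := by
    refine Module.nontrivial_of_finrank_pos (R := ℝ) ?_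
    rw [finrank_euclideanSpace_fin]
    omega
  have hvol : volume (T \ {y}) = ENNReal.ofReal ((r / D) ^ d) * volume S := by
    rw [measure_sdiff_null (measure_singleton y), hT, Measure.addHaar_image_homothety,
      finrank_euclideanSpace_fin, abs_of_pos (by positivity)]
  have hmeas : ENNReal.ofReal a * (ENNReal.ofReal ((r / D) ^ d) * volume S) ≤
      ν {x | Near r x y} := by
    rw [← hvol]
    refine le_trans ?_ (measure_mono hTn)
    rw [hν, withDensity_apply _ (hTm.diff (measurableSet_singleton y)),
      ← setLIntegral_const]
    refine setLIntegral_mono_ae' (hTm.diff (measurableSet_singleton y)) (ae_of_all _ fun x hx => ?_)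
    exact ENNReal.ofReal_le_ofReal (hfa x (hTS hx.1))
  rw [Measure.real, ← ENNReal.ofReal_le_iff_le_toReal (measure_ne_top _ _)]
  refine le_trans (le_of_eq ?_) hmeas
  rw [← ENNReal.ofReal_toReal hfin, ← ENNReal.ofReal_mul (by positivity),
    ← ENNReal.ofReal_mul (by positivity), ENNReal.toReal_ofReal hV.le]
  congr 1
  rw [div_pow]
  ring

end Density

/-! ### Neighbour counts and their averaged exponential potential -/

section Near

variable {E : Type*} [PseudoMetricSpace E]

open Classical in
/-- The number of points `x 1, …, x l` within distance `δ` of `y` but not at `y`. -/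
noncomputable def nearCount (x : ℕ → E) (δ : ℝ) (l : ℕ) (y : E) : ℕ :=
  ∑ i ∈ Finset.Icc 1 l, if Near δ (x i) y then 1 else 0

/-- Arrival `j` is good if it has at least `t` earlier vertices within distance `δ (j - 1)`. -/
def GoodArrival (x : ℕ → E) (δ : ℕ → ℝ) (t : ℝ) (j : ℕ) : Prop :=
  t ≤ nearCount x (δ (j - 1)) (j - 1) (x j)

/-- The average over `y` of `2 ^ (- nearCount y)`. -/
noncomputable def nearPot [MeasurableSpace E] (ν : Measure E) (x : ℕ → E) (δ : ℝ) (l : ℕ) : ℝ :=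
  ∫ y, (1 / 2 : ℝ) ^ nearCount x δ l y ∂ν

theorem nearCount_congr {x x' : ℕ → E} {δ : ℝ} {l : ℕ} (h : ∀ i, 1 ≤ i → i ≤ l → x i = x' i)
    (y : E) : nearCount x δ l y = nearCount x' δ l y := by
  refine Finset.sum_congr rfl fun i hi => ?_
  rw [Finset.mem_Icc] at hi
  rw [h i hi.1 hi.2]

open Classical in
theorem nearCount_succ (x : ℕ → E) (δ : ℝ) (l : ℕ) (y : E) :
    nearCount x δ (l + 1) y = nearCount x δ l y + if Near δ (x (l + 1)) y then 1 else 0 := by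
  unfold nearCount
  rw [Finset.sum_Icc_succ_top (by omega)]

theorem half_pow_le_one (n : ℕ) : (1 / 2 : ℝ) ^ n ≤ 1 := pow_le_one₀ (by norm_num) (by norm_num)

theorem abs_half_pow_le_one (n : ℕ) : |(1 / 2 : ℝ) ^ n| ≤ 1 := by
  rw [abs_of_nonneg (by positivity)]
  exact half_pow_le_one n

theorem nearPot_nonneg [MeasurableSpace E] (ν : Measure E) (x : ℕ → E) (δ : ℝ) (l : ℕ) : 0 ≤ nearPot ν x δ l :=
  integral_nonneg fun _ => by positivity

variable [MeasurableSpace E] [SecondCountableTopology E] [OpensMeasurableSpace E]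
  {α : Type*} [MeasurableSpace α]

theorem measurableSet_near {x y : α → E} (hx : Measurable x) (hy : Measurable y) (δ : ℝ) :
    MeasurableSet {a | Near δ (x a) (y a)} := by
  have h : Measurable fun a => dist (x a) (y a) := hx.dist hy
  exact (measurableSet_lt measurable_const h).inter (measurableSet_le h measurable_const)

theorem measurable_nearCount {x : α → ℕ → E} {y : α → E} {l : ℕ}
    (hx : ∀ i, 1 ≤ i → i ≤ l → Measurable fun a => x a i) (hy : Measurable y) (δ : ℝ) :
    Measurable fun a => nearCount (x a) δ l (y a) := by
  unfold nearCount
  refine Finset.measurable_sum _ fun i hi => ?_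
  rw [Finset.mem_Icc] at hi
  exact Measurable.ite (measurableSet_near (hx i hi.1 hi.2) hy δ) measurable_const measurable_const

theorem measurableSet_goodArrival {x : α → ℕ → E} {δ : ℕ → ℝ} {t : ℝ} {j : ℕ}
    (hx : ∀ i, i ≤ j → Measurable fun a => x a i) :
    MeasurableSet {a | GoodArrival (x a) δ t j} := by
  have h := measurable_nearCount (x := x) (l := j - 1) (fun i _ hi => hx i (by omega))
    (hx j le_rfl) (δ (j - 1))
  exact measurableSet_le measurable_const (measurable_from_nat.comp h)

theorem measurable_half_pow_nearCount {x : α → ℕ → E} {y : α → E} {l : ℕ}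
    (hx : ∀ i, 1 ≤ i → i ≤ l → Measurable fun a => x a i) (hy : Measurable y) (δ : ℝ) :
    Measurable fun a => (1 / 2 : ℝ) ^ nearCount (x a) δ l (y a) :=
  measurable_from_nat.comp (measurable_nearCount hx hy δ)

theorem measurable_nearPot {x : α → ℕ → E} {l : ℕ} (ν : Measure E) [SFinite ν]
    (hx : ∀ i, 1 ≤ i → i ≤ l → Measurable fun a => x a i) (δ : ℝ) :
    Measurable fun a => nearPot ν (x a) δ l := by
  have h : Measurable fun z : α × E => (1 / 2 : ℝ) ^ nearCount (x z.1) δ l z.2 :=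
    measurable_half_pow_nearCount (fun i h1 h2 => (hx i h1 h2).comp measurable_fst) measurable_snd δ
  exact (StronglyMeasurable.integral_prod_right (ν := ν)
    (f := fun a y => (1 / 2 : ℝ) ^ nearCount (x a) δ l y) h.stronglyMeasurable).measurable

theorem integrable_half_pow_nearCount (ν : Measure E) [IsFiniteMeasure ν] (x : ℕ → E) (δ : ℝ)
    (l : ℕ) : Integrable (fun y => (1 / 2 : ℝ) ^ nearCount x δ l y) ν :=
  Integrable.of_bound (measurable_half_pow_nearCount (α := E) (x := fun _ => x)
    (fun _ _ _ => measurable_const) measurable_id δ).aestronglyMeasurable 1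
    (ae_of_all _ fun _ => abs_half_pow_le_one _)

theorem nearPot_le_one (ν : Measure E) [IsProbabilityMeasure ν] (x : ℕ → E) (δ : ℝ) (l : ℕ) :
    nearPot ν x δ l ≤ 1 := by
  refine (integral_mono (integrable_half_pow_nearCount ν x δ l) (integrable_const 1)
    fun y => half_pow_le_one _).trans (by simp)

/-- A new point halves the integrand on its own neighbourhood and nowhere else. -/
theorem nearPot_succ (ν : Measure E) [IsFiniteMeasure ν] (x : ℕ → E) (δ : ℝ) (l : ℕ) :
    nearPot ν x δ (l + 1) = nearPot ν x δ l -
      ∫ y in {y | Near δ (x (l + 1)) y}, (1 / 2 : ℝ) * (1 / 2 : ℝ) ^ nearCount x δ l y ∂ν := by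
  have hs : MeasurableSet {y | Near δ (x (l + 1)) y} :=
    measurableSet_near measurable_const measurable_id δ
  have hi := integrable_half_pow_nearCount ν x δ l
  unfold nearPot
  rw [← integral_indicator hs, ← integral_sub hi ((hi.const_mul _).indicator hs)]
  refine integral_congr_ae (ae_of_all _ fun y => ?_)
  dsimp only
  rw [nearCount_succ]
  by_cases h : Near δ (x (l + 1)) y
  · rw [Set.indicator_of_mem (by exact h), if_pos h, pow_succ]; ring
  · rw [Set.indicator_of_notMem (by exact h), if_neg h, add_zero, sub_zero]

end Near

/-! ### Measurability of the combinatorial quantities -/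

section Measurability

variable {α : Type*} [MeasurableSpace α]

theorem measurable_attachDeg {v : α → ℕ → ℕ} {n : ℕ}
    (hv : ∀ j, 1 ≤ j → j ≤ n → Measurable fun a => v a j) (i : ℕ) :
    Measurable fun a => attachDeg (v a) n i := by
  simp only [attachDeg_eq_sum]
  refine Finset.measurable_sum _ fun j hj => ?_
  rw [Finset.mem_Icc] at hj
  exact (measurable_from_nat (f := fun w => if j = i ∨ w = i then 1 else 0)).comp (hv j hj.1 hj.2)

theorem measurable_goodDeg {v : α → ℕ → ℕ} {G : α → ℕ → Prop} {n : ℕ}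
    (hv : ∀ j, 1 ≤ j → j ≤ n → Measurable fun a => v a j)
    (hG : ∀ j, 1 ≤ j → j ≤ n → MeasurableSet {a | G a j}) (k i : ℕ) :
    Measurable fun a => goodDeg (v a) (G a) k i n := by
  unfold goodDeg
  refine Finset.measurable_sum _ fun j hj => ?_
  rw [Finset.mem_Ioc] at hj
  refine Measurable.ite ?_ measurable_const measurable_const
  refine (hv j (by omega) hj.2 (measurableSet_singleton i)).inter
    ((hG j (by omega) hj.2).inter ?_)
  exact measurable_attachDeg (n := j - 1) (fun j' h1 h2 => hv j' h1 (by omega)) i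
    (Set.finite_lt_nat k).measurableSet

theorem measurable_goodPot {v : α → ℕ → ℕ} {G : α → ℕ → Prop} {n : ℕ}
    (hv : ∀ j, 1 ≤ j → j ≤ n → Measurable fun a => v a j)
    (hG : ∀ j, 1 ≤ j → j ≤ n → MeasurableSet {a | G a j}) (k a : ℕ) :
    Measurable fun ω => goodPot (v ω) (G ω) k a n := by
  unfold goodPot
  exact Finset.measurable_sum _ fun i _ =>
    measurable_from_nat.comp (measurable_goodDeg hv hG k i)

theorem measurable_badCount {G : α → ℕ → Prop} {n : ℕ}
    (hG : ∀ j, 1 ≤ j → j ≤ n → MeasurableSet {a | G a j}) (a : ℕ) :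
    Measurable fun ω => badCount (G ω) a n := by
  unfold badCount
  refine Finset.measurable_sum _ fun j hj => ?_
  rw [Finset.mem_Ioc] at hj
  exact Measurable.ite (hG j (by omega) hj.2) measurable_const measurable_const

end Measurability

/-! ### Bound on the attachment probability at a good arrival -/

section AttachProb

variable {d : ℕ} {x : ℕ → EuclideanSpace ℝ (Fin d)} {v : ℕ → ℕ} {s : ℝ}

/-- If many vertices lie near the new site then a vertex of degree at most `k` is unlikely to be
chosen unless it is near as well. -/
theorem attachProb_le (hs : 0 < s) (h1 : v 1 = 0) {n i : ℕ} (hn : 1 ≤ n) (hi : i ≤ n)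
    {δ t k : ℝ} (hδ : 0 < δ) (ht : 0 < t) (hgood : t ≤ nearCount x δ n (x (n + 1)))
    (hdeg : (attachDeg v n i : ℝ) ≤ k) :
    attachProb (fun r => r ^ (-s)) x v n i ≤
      min 1 ((δ * (k / t) ^ (1 / s) / dist (x i) (x (n + 1))) ^ s) := by
  classical
  have hk : 0 ≤ k := (Nat.cast_nonneg _).trans hdeg
  have hterm : ∀ j, 0 ≤ (attachDeg v n j : ℝ) * (dist (x j) (x (n + 1))) ^ (-s) :=
    fun j => by positivity
  -- Each of the at least t near vertices has degree at least 1 and kernel value at least δ^(-s).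
  have hD : t * δ ^ (-s) ≤ attachTotal (fun r => r ^ (-s)) x v n (x (n + 1)) := by
    calc t * δ ^ (-s) ≤ nearCount x δ n (x (n + 1)) * δ ^ (-s) := by gcongr
      _ = ∑ j ∈ Finset.Icc 1 n, if Near δ (x j) (x (n + 1)) then δ ^ (-s) else 0 := by
          rw [nearCount, Nat.cast_sum, Finset.sum_mul]
          refine Finset.sum_congr rfl fun j _ => ?_
          split_ifs <;> simp
      _ ≤ ∑ j ∈ Finset.Icc 1 n, (attachDeg v n j : ℝ) * (dist (x j) (x (n + 1))) ^ (-s) := by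
          refine Finset.sum_le_sum fun j hj => ?_
          rw [Finset.mem_Icc] at hj
          split_ifs with hnear
          · have h2 : (1 : ℝ) ≤ attachDeg v n j := by
              exact_mod_cast one_le_attachDeg h1 hn hj.2
            have h3 := Real.rpow_le_rpow_of_nonpos hnear.1 hnear.2 (neg_nonpos.mpr hs.le)
            have h4 : 0 ≤ δ ^ (-s) := by positivity
            nlinarith
          · exact hterm j
      _ ≤ _ := Finset.sum_le_sum_of_subset_of_nonneg (fun j hj => by
          rw [Finset.mem_Icc] at hj
          exact Finset.mem_range.mpr (by omega)) fun j _ _ => hterm j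
  have hD0 : 0 < t * δ ^ (-s) := by positivity
  have hDpos := hD0.trans_le hD
  unfold attachProb
  refine le_min ?_ ?_
  · rw [div_le_one hDpos]
    exact Finset.single_le_sum (f := fun j => (attachDeg v n j : ℝ) *
      (dist (x j) (x (n + 1))) ^ (-s)) (fun j _ => hterm j) (Finset.mem_range.mpr (by omega))
  -- At distance 0 the convention 0^(-s) = 0 makes the attachment probability 0; this is also why
  -- `Near` excludes the centre.
  · rcases (dist_nonneg (x := x i) (y := x (n + 1))).eq_or_lt with h0 | hpos
    · dsimp only
      rw [← h0, Real.zero_rpow (neg_ne_zero.mpr hs.ne'), mul_zero, zero_div]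
      positivity
    · calc _ ≤ k * (dist (x i) (x (n + 1))) ^ (-s) / (t * δ ^ (-s)) := by gcongr
        _ = _ := by
          rw [Real.div_rpow (by positivity) hpos.le, Real.mul_rpow hδ.le (by positivity),
            ← Real.rpow_mul (by positivity), one_div, inv_mul_cancel₀ hs.ne', Real.rpow_one,
            Real.rpow_neg hpos.le, Real.rpow_neg hδ.le]
          field_simp

end AttachProb

/-! ### One-step contraction of the neighbour potential -/

section NearStep

variable {E : Type*} [PseudoMetricSpace E] [MeasurableSpace E] [SecondCountableTopology E]
  [OpensMeasurableSpace E]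

/-- Adding a random point shrinks the averaged potential by a constant factor. -/
theorem integral_nearPot_update_le (ν : Measure E) [IsProbabilityMeasure ν] (x : ℕ → E) {δ p : ℝ}
    (hp : ∀ᵐ y ∂ν, p ≤ ν.real {x | Near δ x y}) (l : ℕ) :
    ∫ z, nearPot ν (Function.update x (l + 1) z) δ (l + 1) ∂ν ≤ (1 - p / 2) * nearPot ν x δ l := by
  classical
  have hpt : ∀ z y : E, (1 / 2 : ℝ) ^ nearCount (Function.update x (l + 1) z) δ (l + 1) y =
      (1 / 2 : ℝ) ^ nearCount x δ l y * if Near δ z y then 1 / 2 else 1 := by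
    intro z y
    rw [nearCount_succ, Function.update_self, pow_add, nearCount_congr (x' := x) fun i _ h2 =>
      Function.update_of_ne (show i ≠ l + 1 by omega) z x]
    split_ifs <;> simp
  have hnear : ∀ y : E, MeasurableSet {z | Near δ z y} := fun y =>
    measurableSet_near measurable_id measurable_const δ
  have hcm : Measurable fun y => (1 / 2 : ℝ) ^ nearCount x δ l y :=
    measurable_half_pow_nearCount (α := E) (x := fun _ => x)
      (fun _ _ _ => measurable_const) measurable_id δ
  have hin : ∀ y : E, ∫ z, (if Near δ z y then (1 / 2 : ℝ) else 1) ∂ν =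
      1 - ν.real {z | Near δ z y} / 2 := by
    intro y
    have : ∀ z : E, (if Near δ z y then (1 / 2 : ℝ) else 1) =
        1 - {z | Near δ z y}.indicator (fun _ => 1 / 2) z := by
      intro z
      by_cases h : Near δ z y
      · rw [Set.indicator_of_mem (by exact h), if_pos h]; norm_num
      · rw [Set.indicator_of_notMem (by exact h), if_neg h, sub_zero]
    simp_rw [this]
    rw [integral_sub (integrable_const _) ((integrable_const _).indicator (hnear y)),
      integral_indicator_const _ (hnear y)]
    simp [div_eq_mul_inv]
  have hm : Measurable (Function.uncurry fun z y : E => (1 / 2 : ℝ) ^ nearCount x δ l y *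
      if Near δ z y then (1 / 2 : ℝ) else 1) :=
    (hcm.comp measurable_snd).mul (Measurable.ite
      (measurableSet_near measurable_fst measurable_snd δ) measurable_const measurable_const)
  have hle : ∀ z y : E, |if Near δ z y then (1 / 2 : ℝ) else 1| ≤ 1 := by
    intro z y
    split_ifs <;> norm_num
  unfold nearPot
  simp_rw [hpt]
  -- Integrating the new point first, at fixed y, produces the factor 1 - ν(ball about y)/2, to
  -- which the lower mass bound applies.
  rw [integral_integral_swap (Integrable.of_bound hm.aestronglyMeasurable 1 (ae_of_all _ fun z => by
    rw [Function.uncurry, Real.norm_eq_abs, abs_mul]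
    exact mul_le_one₀ (abs_half_pow_le_one _) (abs_nonneg _) (hle _ _)))]
  simp_rw [integral_const_mul, hin]
  rw [← integral_const_mul]
  refine integral_mono_of_nonneg (ae_of_all _ fun y => ?_)
    ((integrable_half_pow_nearCount ν x δ l).const_mul _) ?_
  · have : ν.real {z | Near δ z y} ≤ 1 := measureReal_le_one
    exact mul_nonneg (by positivity) (by linarith)
  · filter_upwards [hp] with y hy
    rw [mul_comm]
    gcongr

end NearStep

/-! ### Joint measurability needed for integrating out the next site -/

section UncurryMeasurable

variable {α E : Type*} [mα : MeasurableSpace α] [PseudoMetricSpace E] [MeasurableSpace E]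
  [SecondCountableTopology E] [OpensMeasurableSpace E] {W : α → ℝ}

theorem measurable_uncurry_mul_min (hW : Measurable W) {x : α → E} (hx : Measurable x) (R s : ℝ) :
    Measurable (Function.uncurry fun a y => W a * min 1 ((R / dist (x a) y) ^ s)) := by
  have h : Measurable fun z : α × E => dist (x z.1) z.2 :=
    (hx.comp measurable_fst).dist measurable_snd
  exact (hW.comp measurable_fst).mul (measurable_const.min ((h.const_div R).pow_const s))

theorem measurable_uncurry_mul_half_pow (hW : Measurable W) {x : α → ℕ → E} {l : ℕ}
    (hx : ∀ i, 1 ≤ i → i ≤ l → Measurable fun a => x a i) (c δ : ℝ) :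
    Measurable (Function.uncurry fun a y => W a * (c * (1 / 2) ^ nearCount (x a) δ l y)) :=
  (hW.comp measurable_fst).mul ((measurable_half_pow_nearCount (x := fun z : α × E => x z.1)
    (fun i h1 h2 => (hx i h1 h2).comp measurable_fst) measurable_snd δ).const_mul c)

theorem measurable_uncurry_mul_nearPot (ν : Measure E) [SFinite ν] (hW : Measurable W)
    {x : α → ℕ → E} {l : ℕ} (hx : ∀ i, 1 ≤ i → i ≤ l → Measurable fun a => x a i) (δ : ℝ) :
    Measurable (Function.uncurry fun a z =>
      W a * nearPot ν (Function.update (x a) (l + 1) z) δ (l + 1)) := by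
  refine (hW.comp measurable_fst).mul (measurable_nearPot
    (x := fun z : α × E => Function.update (x z.1) (l + 1) z.2) ν (fun i h1 h2 => ?_) δ)
  rcases Nat.lt_or_ge l i with hlt | hge
  · obtain rfl : i = l + 1 := by omega
    simp only [Function.update_self]
    exact measurable_snd
  · simp only [Function.update_of_ne (show i ≠ l + 1 by omega)]
    exact (hx i h1 hge).comp measurable_fst

end UncurryMeasurable

/-! ### History σ-algebras and the attachment rule in integrated form -/

section History

/-- The σ-algebra generated by the graph on `0, …, n`, its sites and the site of the next vertex. -/
abbrev gpaNextHistory {Ω : Type*} {d : ℕ} (X : ℕ → Ω → EuclideanSpace ℝ (Fin d)) (v : ℕ → Ω → ℕ)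
    (n : ℕ) : MeasurableSpace Ω :=
  gpaHistory X v n ⊔ MeasurableSpace.comap (X (n + 1)) inferInstance

theorem measurable_site_history {Ω : Type*} {d : ℕ} {X : ℕ → Ω → EuclideanSpace ℝ (Fin d)}
    {v : ℕ → Ω → ℕ} {i n : ℕ} (hi : i ≤ n) :
    Measurable[gpaHistory X v n] (X i) := by
  refine Measurable.mono (comap_measurable (X i)) ?_ le_rfl
  exact le_sup_of_le_left (le_iSup₂_of_le i (Finset.mem_range.mpr (by omega)) le_rfl)

theorem measurable_choice_history {Ω : Type*} {d : ℕ} {X : ℕ → Ω → EuclideanSpace ℝ (Fin d)}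
    {v : ℕ → Ω → ℕ} {j n : ℕ} (h1 : 1 ≤ j) (hj : j ≤ n) :
    Measurable[gpaHistory X v n] (v j) := by
  refine Measurable.mono (comap_measurable (v j)) ?_ le_rfl
  exact le_sup_of_le_right (le_iSup₂_of_le j (Finset.mem_Icc.mpr ⟨h1, hj⟩) le_rfl)

variable {Ω : Type*} [mΩ : MeasurableSpace Ω] {μ : Measure Ω} {d : ℕ}
  {f : EuclideanSpace ℝ (Fin d) → ℝ} {F : ℝ → ℝ} {s : ℝ}
  {X : ℕ → Ω → EuclideanSpace ℝ (Fin d)} {v : ℕ → Ω → ℕ}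

namespace IsGPA

theorem history_le (h : IsGPA μ f F X v) (n : ℕ) : gpaHistory X v n ≤ mΩ := by
  refine sup_le (iSup₂_le fun i _ => ?_) (iSup₂_le fun j hj => ?_)
  · exact (h.measurable_site i).comap_le
  · exact (h.measurable_choice j (Finset.mem_Icc.mp hj).1).comap_le

theorem choice_lt (h : IsGPA μ f F X v) (ω : Ω) (j : ℕ) (hj : 1 ≤ j) : v j ω < j := by
  obtain ⟨n, rfl⟩ : ∃ n, j = n + 1 := ⟨j - 1, by omega⟩
  rcases Nat.eq_zero_or_pos n with rfl | hn
  · rw [zero_add, h.choice_one]; omega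
  · exact Nat.lt_succ_of_le (h.choice_le n hn ω)

variable [IsProbabilityMeasure μ]

theorem isProbabilityMeasure_law (h : IsGPA μ f F X v) :
    IsProbabilityMeasure (volume.withDensity fun x => ENNReal.ofReal (f x)) := by
  rw [← h.law_site 0]
  exact Measure.isProbabilityMeasure_map (h.measurable_site 0).aemeasurable

/-- Pulling a bounded weight out of the conditional expectation turns the rule into an identity of
integrals; all later drift estimates are of this tested form. -/
theorem integral_mul_choice (h : IsGPA μ f F X v) {n i : ℕ} (hn : 1 ≤ n) (hi : i ≤ n) {W : Ω → ℝ}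
    (hW : Measurable[gpaNextHistory X v n] W) {K : ℝ}
    (hK : ∀ ω, |W ω| ≤ K) :
    ∫ ω, W ω * ({ω | v (n + 1) ω = i}).indicator (fun _ => (1 : ℝ)) ω ∂μ =
      ∫ ω, W ω * attachProb F (fun m => X m ω) (fun m => v m ω) n i ∂μ := by
  have hle : gpaNextHistory X v n ≤ mΩ := sup_le (h.history_le n) (h.measurable_site (n + 1)).comap_le
  have hAm : MeasurableSet {ω | v (n + 1) ω = i} :=
    h.measurable_choice (n + 1) (by omega) (measurableSet_singleton i)
  set A := ({ω | v (n + 1) ω = i}).indicator (fun _ => (1 : ℝ)) with hA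
  have hAi : Integrable A μ := (integrable_const 1).indicator hAm
  have hWA : Integrable (W * A) μ := by
    refine hAi.bdd_mul (c := K) (hW.mono hle le_rfl).aestronglyMeasurable (ae_of_all _ hK)
  calc ∫ ω, W ω * A ω ∂μ = ∫ ω, (μ[W * A | gpaNextHistory X v n]) ω ∂μ := (integral_condExp hle).symm
    _ = ∫ ω, W ω * attachProb F (fun m => X m ω) (fun m => v m ω) n i ∂μ := by
      refine integral_congr_ae ?_
      filter_upwards [condExp_mul_of_stronglyMeasurable_left hW.stronglyMeasurable hWA hAi,
        h.rule n hn i hi] with ω h1 h2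
      rw [h1, Pi.mul_apply, h2]

end IsGPA

end History

/-! ### One-step drift estimates tested against history-measurable weights -/

section Drift

variable {Ω : Type*} [mΩ : MeasurableSpace Ω] {μ : Measure Ω} [IsProbabilityMeasure μ] {d : ℕ}
  {f : EuclideanSpace ℝ (Fin d) → ℝ} {s : ℝ}
  {X : ℕ → Ω → EuclideanSpace ℝ (Fin d)} {v : ℕ → Ω → ℕ}

local notation "law" => volume.withDensity fun x => ENNReal.ofReal (f x)

namespace IsGPA

open Classical in
/-- The rate at which a vertex of degree below `k` attracts good arrivals. -/
theorem integral_mul_goodChoice_le (h : IsGPA μ f (fun r => r ^ (-s)) X v) (hs : 0 < s) {n i : ℕ}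
    (hn : 1 ≤ n) (hi : i ≤ n) {W : Ω → ℝ} (hW : Measurable[gpaHistory X v n] W) {K : ℝ}
    (hW0 : ∀ ω, 0 ≤ W ω) (hK : ∀ ω, W ω ≤ K) {δ : ℕ → ℝ} (hδ : 0 < δ n) {t : ℝ} (ht : 0 < t)
    {k : ℕ} {κ : ℝ} (hκ : ∀ x, ∫ y, min 1 ((δ n * (k / t) ^ (1 / s) / dist x y) ^ s) ∂law ≤ κ) :
    ∫ ω, W ω * (if v (n + 1) ω = i ∧ GoodArrival (fun m => X m ω) δ t (n + 1) ∧
      attachDeg (fun m => v m ω) n i < k then 1 else 0) ∂μ ≤ κ * ∫ ω, W ω ∂μ := by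
  have hprob := h.isProbabilityMeasure_law
  have hle : gpaNextHistory X v n ≤ mΩ := sup_le (h.history_le n) (h.measurable_site (n + 1)).comap_le
  have hXnext : ∀ i ≤ n + 1, Measurable[gpaNextHistory X v n] (X i) := by
    intro i hi
    rcases Nat.lt_or_ge n i with hlt | hge
    · obtain rfl : i = n + 1 := by omega
      exact (comap_measurable (X (n + 1))).mono le_sup_right le_rfl
    · exact (measurable_site_history hge).mono le_sup_left le_rfl
  have hvnext : ∀ j, 1 ≤ j → j ≤ n → Measurable[gpaNextHistory X v n] (v j) := fun j h1 h2 =>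
    (measurable_choice_history h1 h2).mono le_sup_left le_rfl
  have hgood : MeasurableSet[gpaNextHistory X v n] {ω | GoodArrival (fun m => X m ω) δ t (n + 1)} :=
    @measurableSet_goodArrival _ _ _ _ _ Ω (gpaNextHistory X v n) (fun ω m => X m ω) δ t (n + 1) hXnext
  have hdeg : MeasurableSet[gpaNextHistory X v n] {ω | attachDeg (fun m => v m ω) n i < k} :=
    @measurable_attachDeg Ω (gpaNextHistory X v n) (fun ω m => v m ω) n hvnext i _ (Set.finite_lt_nat k).measurableSet
  -- Goodness depends on the site of the newcomer, so the weight cut off by `B` is measurable only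
  -- for the larger σ-algebra that includes this site; that is the one the rule conditions on.
  set B := {ω | GoodArrival (fun m => X m ω) δ t (n + 1)} ∩
    {ω | attachDeg (fun m => v m ω) n i < k} with hB
  have hBm : MeasurableSet[gpaNextHistory X v n] B := hgood.inter hdeg
  have hWB : Measurable[gpaNextHistory X v n] (B.indicator W) := (hW.mono le_sup_left le_rfl).indicator hBm
  have hKB : ∀ ω, |B.indicator W ω| ≤ K := by
    intro ω
    by_cases hω : ω ∈ B
    · rw [Set.indicator_of_mem hω, abs_of_nonneg (hW0 ω)]; exact hK ω
    · rw [Set.indicator_of_notMem hω, abs_zero]; exact (hW0 ω).trans (hK ω)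
  set R := δ n * (k / t) ^ (1 / s) with hR
  have hWm : Measurable W := hW.mono (h.history_le n) le_rfl
  have hmin1 : ∀ x y : EuclideanSpace ℝ (Fin d), |min 1 ((R / dist x y) ^ s)| ≤ 1 := by
    intro x y
    rw [abs_of_nonneg (le_min zero_le_one (by positivity))]
    exact min_le_left _ _
  have hmm : Measurable fun z : EuclideanSpace ℝ (Fin d) × EuclideanSpace ℝ (Fin d) =>
      min 1 ((R / dist z.1 z.2) ^ s) := by fun_prop
  have hWabs : ∀ ω, |W ω| ≤ K := fun ω => by rw [abs_of_nonneg (hW0 ω)]; exact hK ω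
  have hbdd : ∀ ω y, |W ω * min 1 ((R / dist (X i ω) y) ^ s)| ≤ K := by
    intro ω y
    rw [abs_mul, ← mul_one K]
    exact mul_le_mul (hWabs ω) (hmin1 _ _) (abs_nonneg _) ((abs_nonneg _).trans (hWabs ω))
  have hXi := h.measurable_site i
  have hXn := h.measurable_site (n + 1)
  calc _ = ∫ ω, B.indicator W ω * ({ω | v (n + 1) ω = i}).indicator (fun _ => (1 : ℝ)) ω ∂μ := by
        refine integral_congr_ae (ae_of_all _ fun ω => ?_)
        dsimp only
        by_cases h1 : v (n + 1) ω = i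
        · rw [Set.indicator_of_mem (s := {ω | v (n + 1) ω = i}) (by exact h1)]
          by_cases h2 : ω ∈ B
          · rw [Set.indicator_of_mem h2, if_pos ⟨h1, h2.1, h2.2⟩]
          · rw [Set.indicator_of_notMem h2, if_neg fun h3 => h2 ⟨h3.2.1, h3.2.2⟩]; simp
        · rw [Set.indicator_of_notMem (s := {ω | v (n + 1) ω = i}) (by exact h1),
            if_neg fun h3 => h1 h3.1]
          simp
    _ = ∫ ω, B.indicator W ω *
          attachProb (fun r => r ^ (-s)) (fun m => X m ω) (fun m => v m ω) n i ∂μ :=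
        h.integral_mul_choice hn hi hWB hKB
    _ ≤ ∫ ω, W ω * min 1 ((R / dist (X i ω) (X (n + 1) ω)) ^ s) ∂μ := by
        refine integral_mono_of_nonneg (ae_of_all _ fun ω => ?_)
          (Integrable.of_bound ?_ K (ae_of_all _ fun ω => hbdd ω _)) (ae_of_all _ fun ω => ?_)
        · refine mul_nonneg (Set.indicator_nonneg (fun ω _ => hW0 ω) ω) ?_
          unfold attachProb attachTotal
          positivity
        · exact (hWm.mul (hmm.comp (hXi.prodMk hXn))).aestronglyMeasurable
        · dsimp only
          by_cases h2 : ω ∈ B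
          · rw [Set.indicator_of_mem h2]
            refine mul_le_mul_of_nonneg_left ?_ (hW0 ω)
            exact attachProb_le hs (h.choice_one ω) hn hi hδ ht h2.1
              (by exact_mod_cast (le_of_lt h2.2))
          · rw [Set.indicator_of_notMem h2, zero_mul]
            exact mul_nonneg (hW0 ω) (le_min zero_le_one (by positivity))
    _ = ∫ ω, ∫ y, W ω * min 1 ((R / dist (X i ω) y) ^ s) ∂law ∂μ := by
        rw [← h.law_site (n + 1)]
        refine integral_freeze (h.history_le n) hXn (h.indep_history n)
          (g := fun ω y => W ω * min 1 ((R / dist (X i ω) y) ^ s)) ?_ hbdd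
        exact measurable_uncurry_mul_min (mα := gpaHistory X v n) hW (measurable_site_history hi) R s
    _ ≤ ∫ ω, κ * W ω ∂μ := by
        refine integral_mono_of_nonneg (ae_of_all _ fun ω => ?_)
          ((Integrable.of_bound hWm.aestronglyMeasurable K (ae_of_all _ hWabs)).const_mul κ)
          (ae_of_all _ fun ω => ?_)
        · exact integral_nonneg fun y => mul_nonneg (hW0 ω) (le_min zero_le_one (by positivity))
        · dsimp only
          rw [integral_const_mul, mul_comm]
          exact mul_le_mul_of_nonneg_right (hκ _) (hW0 ω)
    _ = κ * ∫ ω, W ω ∂μ := integral_const_mul _ _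

open Classical in
/-- The conditional probability of a bad arrival is controlled by the averaged potential. -/
theorem integral_mul_bad_le (h : IsGPA μ f (fun r => r ^ (-s)) X v) {n : ℕ}
    {W : Ω → ℝ} (hW : Measurable[gpaHistory X v n] W) {K : ℝ}
    (hW0 : ∀ ω, 0 ≤ W ω) (hK : ∀ ω, W ω ≤ K) (δ : ℕ → ℝ) (t : ℝ) :
    ∫ ω, W ω * (if GoodArrival (fun m => X m ω) δ t (n + 1) then 0 else 1) ∂μ ≤
      ∫ ω, W ω * (Real.exp t * nearPot law (fun m => X m ω) (δ n) n) ∂μ := by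
  have hprob := h.isProbabilityMeasure_law
  have hXn := h.measurable_site (n + 1)
  have hWm : Measurable W := hW.mono (h.history_le n) le_rfl
  have hWabs : ∀ ω, |W ω| ≤ K := fun ω => by rw [abs_of_nonneg (hW0 ω)]; exact hK ω
  set g : Ω → EuclideanSpace ℝ (Fin d) → ℝ := fun ω y =>
    W ω * (Real.exp t * (1 / 2) ^ nearCount (fun m => X m ω) (δ n) n y) with hg
  have hbdd : ∀ ω y, |g ω y| ≤ K * Real.exp t := by
    intro ω y
    rw [hg, abs_mul, abs_mul, abs_of_pos (Real.exp_pos t)]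
    refine mul_le_mul (hWabs ω) (mul_le_of_le_one_right (Real.exp_pos t).le
      (abs_half_pow_le_one _)) (by positivity) ((abs_nonneg _).trans (hWabs ω))
  have hgm : Measurable fun ω => g ω (X (n + 1) ω) :=
    hWm.mul ((measurable_half_pow_nearCount (x := fun ω m => X m ω)
      (fun i _ _ => h.measurable_site i) hXn (δ n)).const_mul _)
  calc _ ≤ ∫ ω, g ω (X (n + 1) ω) ∂μ := by
        refine integral_mono_of_nonneg (ae_of_all _ fun ω => ?_)
          (Integrable.of_bound hgm.aestronglyMeasurable _ (ae_of_all _ fun ω => hbdd ω _))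
          (ae_of_all _ fun ω => ?_)
        · exact mul_nonneg (hW0 ω) (by split_ifs <;> norm_num)
        · refine mul_le_mul_of_nonneg_left ?_ (hW0 ω)
          split_ifs with hgood
          · positivity
          -- Chernoff: a count N < t gives 1 ≤ e^(t-N) ≤ e^t 2^(-N), since e ≥ 2.
          · have hlt : (nearCount (fun m => X m ω) (δ n) n (X (n + 1) ω) : ℝ) < t :=
              not_le.mp hgood
            have h2 : (1 / 2 : ℝ) ≥ Real.exp (-1) := by
              rw [Real.exp_neg, ge_iff_le, one_div]
              exact inv_anti₀ two_pos (by have := Real.add_one_le_exp 1; linarith)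
            calc (1 : ℝ) = Real.exp t * Real.exp (-t) := by rw [← Real.exp_add]; simp
              _ ≤ Real.exp t *
                  Real.exp (nearCount (fun m => X m ω) (δ n) n (X (n + 1) ω) * (-1)) := by
                  gcongr; linarith
              _ = Real.exp t * Real.exp (-1) ^ nearCount (fun m => X m ω) (δ n) n (X (n + 1) ω) := by
                  rw [Real.exp_nat_mul]
              _ ≤ _ := by gcongr
    _ = ∫ ω, ∫ y, g ω y ∂law ∂μ := by
        rw [← h.law_site (n + 1)]
        refine integral_freeze (h.history_le n) hXn (h.indep_history n) (g := g) ?_ hbdd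
        exact measurable_uncurry_mul_half_pow (mα := gpaHistory X v n) (x := fun ω m => X m ω) hW
          (fun i _ h2 => measurable_site_history h2) _ _
    _ = _ := by
        simp_rw [hg, integral_const_mul]
        rfl

/-- The averaged potential decreases geometrically in mean. -/
theorem integral_mul_nearPot_succ_le (h : IsGPA μ f (fun r => r ^ (-s)) X v) {l : ℕ}
    {W : Ω → ℝ} (hW : Measurable[gpaHistory X v l] W) {K : ℝ}
    (hW0 : ∀ ω, 0 ≤ W ω) (hK : ∀ ω, W ω ≤ K) {δ p : ℝ}
    (hp : ∀ᵐ y ∂law, p ≤ (law).real {x | Near δ x y}) :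
    ∫ ω, W ω * nearPot law (fun m => X m ω) δ (l + 1) ∂μ ≤
      ∫ ω, W ω * ((1 - p / 2) * nearPot law (fun m => X m ω) δ l) ∂μ := by
  have hprob := h.isProbabilityMeasure_law
  have hXn := h.measurable_site (l + 1)
  have hWm : Measurable W := hW.mono (h.history_le l) le_rfl
  have hWabs : ∀ ω, |W ω| ≤ K := fun ω => by rw [abs_of_nonneg (hW0 ω)]; exact hK ω
  have hpabs : ∀ (x : ℕ → EuclideanSpace ℝ (Fin d)) (l : ℕ), |nearPot law x δ l| ≤ 1 := by
    intro x l
    rw [abs_of_nonneg (nearPot_nonneg _ _ _ _)]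
    exact nearPot_le_one _ _ _ _
  -- Overwriting the site l+1 by z separates the fresh site from the history.
  set g : Ω → EuclideanSpace ℝ (Fin d) → ℝ := fun ω z =>
    W ω * nearPot law (Function.update (fun m => X m ω) (l + 1) z) δ (l + 1) with hg
  have hbdd : ∀ ω y, |g ω y| ≤ K := by
    intro ω y
    rw [hg, abs_mul, ← mul_one K]
    exact mul_le_mul (hWabs ω) (hpabs _ _) (abs_nonneg _) ((abs_nonneg _).trans (hWabs ω))
  calc _ = ∫ ω, g ω (X (l + 1) ω) ∂μ := by
        refine integral_congr_ae (ae_of_all _ fun ω => ?_)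
        simp only [hg]
        congr 2
        exact (Function.update_eq_self (l + 1) fun m => X m ω).symm
    _ = ∫ ω, ∫ y, g ω y ∂law ∂μ := by
        rw [← h.law_site (l + 1)]
        refine integral_freeze (h.history_le l) hXn (h.indep_history l) (g := g) ?_ hbdd
        exact measurable_uncurry_mul_nearPot (mα := gpaHistory X v l) (x := fun ω m => X m ω) law hW
          (fun i _ h2 => measurable_site_history h2) _
    _ ≤ _ := by
        have hm : Measurable fun ω => nearPot law (fun m => X m ω) δ l :=
          measurable_nearPot (x := fun ω m => X m ω) law (fun i _ _ => h.measurable_site i) δ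
        refine integral_mono_of_nonneg (ae_of_all _ fun ω => ?_) ?_ (ae_of_all _ fun ω => ?_)
        · exact integral_nonneg fun y => mul_nonneg (hW0 ω) (nearPot_nonneg _ _ _ _)
        · refine Integrable.bdd_mul (c := K) ?_ hWm.aestronglyMeasurable (ae_of_all _ hWabs)
          exact (Integrable.of_bound hm.aestronglyMeasurable 1
            (ae_of_all _ fun ω => hpabs _ _)).const_mul _
        · simp only [hg, integral_const_mul]
          exact mul_le_mul_of_nonneg_left (integral_nearPot_update_le _ _ hp l) (hW0 ω)

end IsGPA

end Drift

/-! ### Three supermartingales and their mean-square bounds -/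

section SecondMoment

theorem integrable_of_abs_le {Ω : Type*} [MeasurableSpace Ω] {μ : Measure Ω} [IsFiniteMeasure μ]
    {g : Ω → ℝ} (hg : Measurable g) {K : ℝ} (hK : ∀ ω, |g ω| ≤ K) : Integrable g μ :=
  Integrable.of_bound hg.aestronglyMeasurable K (ae_of_all _ hK)

theorem measurableSet_goodArrival_history {Ω : Type*} {d : ℕ}
    {X : ℕ → Ω → EuclideanSpace ℝ (Fin d)} {v : ℕ → Ω → ℕ} {δ : ℕ → ℝ} {t : ℝ} {j n : ℕ} (hj : j ≤ n) :
    MeasurableSet[gpaHistory X v n] {ω | GoodArrival (fun m => X m ω) δ t j} :=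
  @measurableSet_goodArrival _ _ _ _ _ Ω (gpaHistory X v n) (fun ω m => X m ω) δ t j
    fun _ hi => measurable_site_history (hi.trans hj)

variable {Ω : Type*} [mΩ : MeasurableSpace Ω] {μ : Measure Ω} [IsProbabilityMeasure μ] {d : ℕ}
  {f : EuclideanSpace ℝ (Fin d) → ℝ} {s : ℝ}
  {X : ℕ → Ω → EuclideanSpace ℝ (Fin d)} {v : ℕ → Ω → ℕ}

local notation "law" => volume.withDensity fun x => ENNReal.ofReal (f x)

namespace IsGPA

/-- The averaged potential exceeds its mean-field value by little, in second moment. -/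
theorem integral_nearPot_sq_le (h : IsGPA μ f (fun r => r ^ (-s)) X v) {δ p q : ℝ} (hp0 : 0 ≤ p)
    (hpq : p ≤ q) (hp1 : p ≤ 1)
    (hp : ∀ᵐ y ∂law, p ≤ (law).real {x | Near δ x y})
    (hq : ∀ x, (law).real {y | Near δ x y} ≤ q) (n : ℕ) :
    Integrable (fun ω => (max (nearPot law (fun m => X m ω) δ n - (1 - p / 2) ^ n) 0) ^ 2) μ ∧
    ∫ ω, (max (nearPot law (fun m => X m ω) δ n - (1 - p / 2) ^ n) 0) ^ 2 ∂μ ≤ n * q ^ 2 := by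
  have hprob := h.isProbabilityMeasure_law
  have hr0 : 0 ≤ 1 - p / 2 := by linarith
  have hr1 : 1 - p / 2 ≤ 1 := by linarith
  set Z : ℕ → Ω → ℝ := fun m ω => nearPot law (fun m => X m ω) δ m - (1 - p / 2) ^ m with hZ
  have hZh : ∀ m, Measurable[gpaHistory X v m] (Z m) := fun m =>
    Measurable.sub_const (@measurable_nearPot _ _ _ _ _ Ω (gpaHistory X v m) (fun ω m => X m ω) m
      law _ (fun i _ hi => measurable_site_history hi) δ) _
  have hZm : ∀ m, Measurable (Z m) := fun m => (hZh m).mono (h.history_le m) le_rfl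
  have hZ1 : ∀ m ω, |Z m ω| ≤ 1 := by
    intro m ω
    have h1 := nearPot_nonneg law (fun m => X m ω) δ m
    have h2 := nearPot_le_one law (fun m => X m ω) δ m
    have h3 := pow_nonneg hr0 m
    have h4 := pow_le_one₀ (n := m) hr0 hr1
    exact abs_le.mpr ⟨by simp only [hZ]; linarith, by simp only [hZ]; linarith⟩
  have hmax : ∀ m ω, max (Z m ω) 0 ≤ 1 := fun m ω =>
    max_le ((le_abs_self _).trans (hZ1 m ω)) zero_le_one
  refine (integral_posPart_sq_le Z q (Nat.zero_le n) (fun m _ _ => hZm m) (fun ω => ?_)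
    (fun m _ _ ω => ?_) (fun m _ _ => ?_)).imp_right fun hle => hle.trans (by simp)
  · simp [hZ, nearPot, nearCount]
  · have e1 := nearPot_succ law (fun m => X m ω) δ m
    set I := ∫ y in {y | Near δ (X (m + 1) ω) y},
      (1 / 2 : ℝ) * (1 / 2 : ℝ) ^ nearCount (fun m => X m ω) δ m y ∂law with hI
    have hI0 : 0 ≤ I := integral_nonneg fun _ => by positivity
    have hI1 : I ≤ q / 2 := by
      have hi := (integrable_half_pow_nearCount law (fun m => X m ω) δ m).const_mul (1 / 2)
      calc I ≤ ∫ y in {y | Near δ (X (m + 1) ω) y}, (1 / 2 : ℝ) ∂law := by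
            refine integral_mono hi.integrableOn (integrable_const _) fun y => ?_
            have := half_pow_le_one (nearCount (fun m => X m ω) δ m y)
            dsimp only
            linarith
        _ ≤ q / 2 := by
            rw [setIntegral_const, smul_eq_mul]
            have := hq (X (m + 1) ω)
            linarith
    have h3 := pow_nonneg hr0 m
    have h4 := pow_le_one₀ (n := m) hr0 hr1
    -- A difference of two numbers in [0, q/2], since p ≤ q.
    have e2 : Z (m + 1) ω - Z m ω = (1 - p / 2) ^ m * (p / 2) - I := by
      simp only [hZ]; rw [e1, pow_succ]; ring
    rw [e2]
    have h5 : 0 ≤ (1 - p / 2) ^ m * (p / 2) := by positivity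
    have h6 : (1 - p / 2) ^ m * (p / 2) ≤ p / 2 := mul_le_of_le_one_left (by linarith) h4
    exact abs_le.mpr ⟨by linarith, by linarith⟩
  · have hWh : Measurable[gpaHistory X v m] fun ω => max (Z m ω) 0 := (hZh m).max measurable_const
    have key := h.integral_mul_nearPot_succ_le hWh (fun ω => le_max_right _ _) (hmax m) hp
    have hWm := (hZm m).max (measurable_const (a := (0 : ℝ)))
    have hN : ∀ m, Measurable fun ω => nearPot law (fun m => X m ω) δ m := fun m =>
      measurable_nearPot (x := fun ω m => X m ω) law (fun i _ _ => h.measurable_site i) δ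
    have hint : ∀ g : Ω → ℝ, Measurable g → (∀ ω, |g ω| ≤ 1) →
        Integrable (fun ω => max (Z m ω) 0 * g ω) μ := fun g hg hg1 =>
      integrable_of_abs_le (K := 1) (hWm.mul hg) fun ω => by
        rw [abs_mul, abs_of_nonneg (le_max_right _ _)]
        exact mul_le_one₀ (hmax m ω) (abs_nonneg _) (hg1 ω)
    have hNb : ∀ m ω, |nearPot law (fun m => X m ω) δ m| ≤ 1 := fun m ω => by
      rw [abs_of_nonneg (nearPot_nonneg _ _ _ _)]; exact nearPot_le_one _ _ _ _
    have i1 := hint _ (hN (m + 1)) (hNb (m + 1))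
    have i2 := hint _ ((hN m).const_mul (1 - p / 2)) (fun ω => by
      rw [abs_mul, abs_of_nonneg hr0]; exact mul_le_one₀ hr1 (abs_nonneg _) (hNb m ω))
    have i3 : Integrable (fun ω => max (Z m ω) 0 * (p / 2 * Z m ω)) μ :=
      hint _ ((hZm m).const_mul (p / 2)) (fun ω => by
        rw [abs_mul, abs_of_nonneg (by linarith)]
        exact mul_le_one₀ (by linarith) (abs_nonneg _) (hZ1 m ω))
    -- The first two terms have nonpositive total mean by the contraction; the third subtracts (p/2)
    -- Z times its positive part, which is nonnegative.
    have e : ∀ ω, max (Z m ω) 0 * (Z (m + 1) ω - Z m ω) =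
        max (Z m ω) 0 * nearPot law (fun m => X m ω) δ (m + 1) -
        max (Z m ω) 0 * ((1 - p / 2) * nearPot law (fun m => X m ω) δ m) -
        max (Z m ω) 0 * (p / 2 * Z m ω) := by
      intro ω; simp only [hZ]; rw [pow_succ]; ring
    have h0 : 0 ≤ ∫ ω, max (Z m ω) 0 * (p / 2 * Z m ω) ∂μ := by
      refine integral_nonneg fun ω => ?_
      rcases max_cases (Z m ω) 0 with ⟨e1, c1⟩ | ⟨e1, c1⟩ <;> simp only [Pi.zero_apply] <;> rw [e1]
      · positivity
      · simp
    have i12 : Integrable (fun ω => max (Z m ω) 0 * nearPot law (fun m => X m ω) δ (m + 1) -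
        max (Z m ω) 0 * ((1 - p / 2) * nearPot law (fun m => X m ω) δ m)) μ := i1.sub i2
    simp_rw [e]
    rw [integral_sub i12 i3, integral_sub i1 i2]
    linarith

/-- The number of bad arrivals exceeds its predictable bound by little, in second moment. -/
theorem integral_badCount_sq_le (h : IsGPA μ f (fun r => r ^ (-s)) X v) (δ : ℕ → ℝ) (t : ℝ)
    {a n : ℕ} (han : a ≤ n) :
    Integrable (fun ω => (max (badCount (GoodArrival (fun m => X m ω) δ t) a n -
      ∑ j ∈ Finset.Ico a n, Real.exp t * nearPot law (fun m => X m ω) (δ j) j) 0) ^ 2) μ ∧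
    ∫ ω, (max (badCount (GoodArrival (fun m => X m ω) δ t) a n -
      ∑ j ∈ Finset.Ico a n, Real.exp t * nearPot law (fun m => X m ω) (δ j) j) 0) ^ 2 ∂μ ≤
      (n - a) * (1 + Real.exp t) ^ 2 := by
  classical
  have hprob := h.isProbabilityMeasure_law
  set Z : ℕ → Ω → ℝ := fun m ω => badCount (GoodArrival (fun m => X m ω) δ t) a m -
      ∑ j ∈ Finset.Ico a m, Real.exp t * nearPot law (fun m => X m ω) (δ j) j with hZ
  have hZh : ∀ m, Measurable[gpaHistory X v m] (Z m) := fun m => by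
    refine Measurable.sub ?_ ?_
    · exact (measurable_from_nat (f := fun r : ℕ => (r : ℝ))).comp
        (@measurable_badCount Ω (gpaHistory X v m) (fun ω => GoodArrival (fun m => X m ω) δ t) m
          (fun j _ hj => measurableSet_goodArrival_history hj) a)
    · refine Finset.measurable_sum _ fun j hj => Measurable.const_mul ?_ _
      rw [Finset.mem_Ico] at hj
      exact @measurable_nearPot _ _ _ _ _ Ω (gpaHistory X v m) (fun ω m => X m ω) j
        law _ (fun i _ hi => measurable_site_history (by omega)) (δ j)
  have hZm : ∀ m, Measurable (Z m) := fun m => (hZh m).mono (h.history_le m) le_rfl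
  have e : ∀ m, a ≤ m → ∀ ω, Z (m + 1) ω - Z m ω =
      (if GoodArrival (fun m => X m ω) δ t (m + 1) then 0 else 1) -
        Real.exp t * nearPot law (fun m => X m ω) (δ m) m := by
    intro m hm ω
    simp only [hZ]
    rw [badCount_succ _ hm, Finset.sum_Ico_succ_top hm]
    split_ifs <;> push_cast <;> ring
  have hNb : ∀ m ω, |Real.exp t * nearPot law (fun m => X m ω) (δ m) m| ≤ Real.exp t :=
    fun m ω => by
      rw [abs_of_nonneg (mul_nonneg (Real.exp_pos t).le (nearPot_nonneg _ _ _ _))]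
      exact mul_le_of_le_one_right (Real.exp_pos t).le (nearPot_le_one _ _ _ _)
  have hone : ∀ m ω, |if GoodArrival (fun m => X m ω) δ t (m + 1) then (0 : ℝ) else 1| ≤ 1 :=
    fun m ω => by split_ifs <;> norm_num
  have hZb : ∀ m ω, Z m ω ≤ m := by
    intro m ω
    have h1 : (badCount (GoodArrival (fun m => X m ω) δ t) a m : ℝ) ≤ m := by
      have : badCount (GoodArrival (fun m => X m ω) δ t) a m ≤ m := by
        unfold badCount
        refine (Finset.sum_le_card_nsmul _ _ 1 fun j _ => by split_ifs <;> omega).trans ?_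
        simp
      exact_mod_cast this
    have h2 : 0 ≤ ∑ j ∈ Finset.Ico a m, Real.exp t * nearPot law (fun m => X m ω) (δ j) j :=
      Finset.sum_nonneg fun j _ => mul_nonneg (Real.exp_pos t).le (nearPot_nonneg _ _ _ _)
    simp only [hZ]
    linarith
  have hmax : ∀ m ω, max (Z m ω) 0 ≤ m := fun m ω => max_le (hZb m ω) (Nat.cast_nonneg m)
  refine integral_posPart_sq_le Z (1 + Real.exp t) han (fun m _ _ => hZm m) (fun ω => ?_)
    (fun m hm _ ω => ?_) (fun m hm _ => ?_)
  · simp [hZ, badCount]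
  · rw [e m hm]
    exact (abs_sub _ _).trans (add_le_add (hone m ω) (hNb m ω))
  · have hWh : Measurable[gpaHistory X v m] fun ω => max (Z m ω) 0 := (hZh m).max measurable_const
    have key := h.integral_mul_bad_le hWh (fun ω => le_max_right _ _) (hmax m) δ t
    have hWm := (hZm m).max (measurable_const (a := (0 : ℝ)))
    have hN : Measurable fun ω => nearPot law (fun m => X m ω) (δ m) m :=
      measurable_nearPot (x := fun ω m => X m ω) law (fun i _ _ => h.measurable_site i) (δ m)
    have hint : ∀ (g : Ω → ℝ) (K : ℝ), Measurable g → (∀ ω, |g ω| ≤ K) →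
        Integrable (fun ω => max (Z m ω) 0 * g ω) μ := fun g K hg hg1 =>
      integrable_of_abs_le (K := m * K) (hWm.mul hg) fun ω => by
        rw [abs_mul, abs_of_nonneg (le_max_right _ _)]
        exact mul_le_mul (hmax m ω) (hg1 ω) (abs_nonneg _) (Nat.cast_nonneg m)
    simp_rw [e m hm, mul_sub]
    rw [integral_sub (hint _ 1 (Measurable.ite (h.history_le (m + 1) _
        (measurableSet_goodArrival_history le_rfl)) measurable_const measurable_const) (hone m))
      (hint _ _ (hN.const_mul _) (hNb m))]
    linarith

/-- The discounted degree potential exceeds the number of vertices by little, in second moment. -/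
theorem integral_goodPot_sq_le (h : IsGPA μ f (fun r => r ^ (-s)) X v) (hs : 0 < s) {δ : ℕ → ℝ}
    {t : ℝ} (ht : 0 < t) {k M a n : ℕ} (ha : 1 ≤ a) (han : a ≤ n) (hδ : ∀ m, a ≤ m → 0 < δ m)
    (hκ : ∀ m, a ≤ m → m < n →
      ∀ x, ∫ y, min 1 ((δ m * (k / t) ^ (1 / s) / dist x y) ^ s) ∂law ≤ M / m) :
    Integrable (fun ω => (max (goodPot (fun m => v m ω) (GoodArrival (fun m => X m ω) δ t) k a n *
      ((a : ℝ) / n) ^ M - (n - a)) 0) ^ 2) μ ∧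
    ∫ ω, (max (goodPot (fun m => v m ω) (GoodArrival (fun m => X m ω) δ t) k a n *
      ((a : ℝ) / n) ^ M - (n - a)) 0) ^ 2 ∂μ ≤ (n - a) * (2 + 2 ^ k + M * 2 ^ k) ^ 2 := by
  classical
  set P : ℕ → Ω → ℝ := fun m ω =>
    goodPot (fun m => v m ω) (GoodArrival (fun m => X m ω) δ t) k a m with hP
  -- This discount cancels the growth factor 1 + M/m, by Bernoulli (`hqup`), and falls by at most
  -- M/m per step (`hqdn`), so increments stay bounded although the potential may reach m 2^k.
  -- Subtracting m - a below pays for the newcomers.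
  set q : ℕ → ℝ := fun m => ((a : ℝ) / m) ^ M with hqdef
  set Z : ℕ → Ω → ℝ := fun m ω => P m ω * q m - (m - a) with hZ
  have ha0 : (0 : ℝ) < a := by exact_mod_cast ha
  have hq0 : ∀ m, 0 ≤ q m := fun m => by positivity
  have hq1 : ∀ m, a ≤ m → q m ≤ 1 := fun m hm => by
    have : (a : ℝ) ≤ m := by exact_mod_cast hm
    exact pow_le_one₀ (by positivity) ((div_le_one (ha0.trans_le this)).mpr this)
  have hqup : ∀ m, a ≤ m → q (m + 1) * (1 + M / m) ≤ q m := by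
    intro m hm
    have hm0 : (0 : ℝ) < m := ha0.trans_le (by exact_mod_cast hm)
    have h1 := one_add_mul_le_pow (a := (1 / m : ℝ)) (by have := one_div_pos.mpr hm0; linarith) M
    calc q (m + 1) * (1 + M / m) ≤ q (m + 1) * (1 + 1 / m) ^ M := by
          refine mul_le_mul_of_nonneg_left ?_ (hq0 _)
          rw [mul_one_div] at h1; exact h1
      _ = q m := by
          simp only [hqdef]
          rw [← mul_pow]; congr 1; push_cast; field_simp
  have hqdn : ∀ m, a ≤ m → m * (q m - q (m + 1)) ≤ M := by
    intro m hm
    have hm0 : (0 : ℝ) < m := ha0.trans_le (by exact_mod_cast hm)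
    have h1 := one_add_mul_le_pow (a := (-(1 / (m + 1)) : ℝ)) (by
      have : (1 : ℝ) / (m + 1) ≤ 1 := by rw [div_le_one (by positivity)]; linarith
      linarith) M
    have h2 : q (m + 1) = q m * (1 + -(1 / (m + 1))) ^ M := by
      simp only [hqdef]
      rw [← mul_pow]; congr 1; push_cast; field_simp; ring
    have h3 : q m - q (m + 1) ≤ q m * (M / (m + 1)) := by
      rw [h2]
      have := mul_le_mul_of_nonneg_left h1 (hq0 m)
      have e : q m * (1 + M * -(1 / (m + 1))) = q m - q m * (M / (m + 1)) := by ring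
      linarith
    have h4 : q m * (M / (m + 1)) ≤ M / (m + 1) :=
      mul_le_of_le_one_left (by positivity) (hq1 m hm)
    calc m * (q m - q (m + 1)) ≤ m * (M / (m + 1)) := by gcongr; linarith
      _ ≤ M := by
          rw [mul_div_assoc', div_le_iff₀ (by positivity)]
          have : (0 : ℝ) ≤ M := Nat.cast_nonneg M
          nlinarith
  have hP0 : ∀ m ω, 0 ≤ P m ω := fun m ω => goodPot_nonneg a m
  have hPle : ∀ m ω, P m ω ≤ m * 2 ^ k := fun m ω => goodPot_le a m
  have hgood : ∀ m j, 1 ≤ j → j ≤ m →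
      MeasurableSet[gpaHistory X v m] {ω | GoodArrival (fun m => X m ω) δ t j} := fun m j _ hj =>
    measurableSet_goodArrival_history hj
  have hPh : ∀ m, Measurable[gpaHistory X v m] (P m) := fun m =>
    @measurable_goodPot Ω (gpaHistory X v m) (fun ω m => v m ω)
      (fun ω => GoodArrival (fun m => X m ω) δ t) m
      (fun j h1 h2 => measurable_choice_history h1 h2) (hgood m) k a
  have hZh : ∀ m, Measurable[gpaHistory X v m] (Z m) := fun m =>
    ((hPh m).mul_const _).sub_const _
  have hZm : ∀ m, Measurable (Z m) := fun m => (hZh m).mono (h.history_le m) le_rfl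
  have hmax : ∀ m, a ≤ m → ∀ ω, max (Z m ω) 0 ≤ m * 2 ^ k := by
    intro m hm ω
    refine max_le ?_ (by positivity)
    have h1 : P m ω * q m ≤ P m ω := mul_le_of_le_one_right (hP0 m ω) (hq1 m hm)
    have h2 : (a : ℝ) ≤ m := by exact_mod_cast hm
    have h3 := hPle m ω
    simp only [hZ]
    linarith
  refine integral_posPart_sq_le Z (2 + 2 ^ k + M * 2 ^ k) han (fun m _ _ => hZm m) (fun ω => ?_)
    (fun m hm _ ω => ?_) (fun m hm hmn => ?_)
  · simp [hZ, hP, goodPot]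
  · have e : Z (m + 1) ω - Z m ω = (P (m + 1) ω - P m ω) * q (m + 1) -
        P m ω * (q m - q (m + 1)) - 1 := by
      simp only [hZ]; push_cast; ring
    have h1 : P (m + 1) ω ≤ P m ω + 1 + 2 ^ k := goodPot_succ_le hm
    have h2 : P m ω ≤ P (m + 1) ω := by
      have e2 : P (m + 1) ω = _ := goodPot_succ (fun m => v m ω)
        (GoodArrival (fun m => X m ω) δ t) k hm
      rw [e2, add_assoc]
      refine le_add_of_nonneg_right (add_nonneg zero_le_one (Finset.sum_nonneg fun i _ => ?_))
      split_ifs <;> simp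
    have h3 : 0 ≤ (P (m + 1) ω - P m ω) * q (m + 1) := mul_nonneg (by linarith) (hq0 _)
    have h4 : (P (m + 1) ω - P m ω) * q (m + 1) ≤ 1 + 2 ^ k :=
      (mul_le_of_le_one_right (by linarith) (hq1 _ (by omega))).trans (by linarith)
    have hqm : q (m + 1) ≤ q m := by
      refine le_trans ?_ (hqup m hm)
      exact le_mul_of_one_le_right (hq0 _) (le_add_of_nonneg_right (by positivity))
    have h5 : 0 ≤ P m ω * (q m - q (m + 1)) := mul_nonneg (hP0 m ω) (by linarith)
    have h6 : P m ω * (q m - q (m + 1)) ≤ M * 2 ^ k := by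
      calc P m ω * (q m - q (m + 1)) ≤ m * 2 ^ k * (q m - q (m + 1)) :=
            mul_le_mul_of_nonneg_right (hPle m ω) (by linarith)
        _ = m * (q m - q (m + 1)) * 2 ^ k := by ring
        _ ≤ M * 2 ^ k := by gcongr; exact hqdn m hm
    rw [e]
    have h7 : (0 : ℝ) < 2 ^ k := by positivity
    exact abs_le.mpr ⟨by linarith, by nlinarith [Nat.cast_nonneg (α := ℝ) M]⟩
  · set W : Ω → ℝ := fun ω => max (Z m ω) 0 with hW
    set g : ℕ → Ω → ℝ := fun i ω =>
      2 ^ goodDeg (fun m => v m ω) (GoodArrival (fun m => X m ω) δ t) k i m with hg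
    set A : ℕ → Ω → ℝ := fun i ω => if v (m + 1) ω = i ∧
      GoodArrival (fun m => X m ω) δ t (m + 1) ∧ attachDeg (fun m => v m ω) m i < k
      then 1 else 0 with hA
    have hWh : Measurable[gpaHistory X v m] W := (hZh m).max measurable_const
    have hWm : Measurable W := (hZm m).max measurable_const
    have hgh : ∀ i, Measurable[gpaHistory X v m] (g i) := fun i =>
      (measurable_from_nat (f := fun r : ℕ => (2 : ℝ) ^ r)).comp
        (@measurable_goodDeg Ω (gpaHistory X v m) (fun ω m => v m ω)
          (fun ω => GoodArrival (fun m => X m ω) δ t) m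
          (fun j h1 h2 => measurable_choice_history h1 h2) (hgood m) k i)
    have hWgh : ∀ i, Measurable[gpaHistory X v m] fun ω => W ω * g i ω := fun i => hWh.mul (hgh i)
    have hW0 : ∀ ω, 0 ≤ W ω := fun ω => le_max_right _ _
    have hg0 : ∀ i ω, 0 ≤ g i ω := fun i ω => by simp only [hg]; positivity
    have hg1 : ∀ i ≤ m, ∀ ω, g i ω ≤ 2 ^ k := fun i hi ω =>
      pow_le_pow_right₀ one_le_two (goodDeg_le hi).2
    have hWg1 : ∀ i ≤ m, ∀ ω, W ω * g i ω ≤ m * 2 ^ k * 2 ^ k := fun i hi ω =>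
      mul_le_mul (hmax m hm ω) (hg1 i hi ω) (hg0 i ω) (by positivity)
    have hAm : ∀ i, Measurable (A i) := fun i => by
      refine Measurable.ite (MeasurableSet.inter ?_ (MeasurableSet.inter ?_ ?_)) measurable_const
        measurable_const
      · exact h.measurable_choice (m + 1) (by omega) (measurableSet_singleton i)
      · exact h.history_le (m + 1) _ (measurableSet_goodArrival_history le_rfl)
      · exact measurable_attachDeg (v := fun ω m => v m ω) (fun j h1 _ => h.measurable_choice j h1) i
          (Set.finite_lt_nat k).measurableSet
    have hA0 : ∀ i ω, 0 ≤ A i ω := fun i ω => by simp only [hA]; split_ifs <;> norm_num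
    have hA1 : ∀ i ω, A i ω ≤ 1 := fun i ω => by simp only [hA]; split_ifs <;> norm_num
    have hWgm : ∀ i, Measurable fun ω => W ω * g i ω := fun i =>
      (hWgh i).mono (h.history_le m) le_rfl
    have hWg0 : ∀ i ω, 0 ≤ W ω * g i ω := fun i ω => mul_nonneg (hW0 ω) (hg0 i ω)
    have iWg : ∀ i ≤ m, Integrable (fun ω => W ω * g i ω) μ := fun i hi =>
      integrable_of_abs_le (hWgm i) fun ω => by
        rw [abs_of_nonneg (hWg0 i ω)]; exact hWg1 i hi ω
    have iWgA : ∀ i ≤ m, Integrable (fun ω => W ω * g i ω * A i ω) μ := fun i hi =>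
      integrable_of_abs_le ((hWgm i).mul (hAm i)) fun ω => by
        rw [abs_of_nonneg (mul_nonneg (hWg0 i ω) (hA0 i ω))]
        exact (mul_le_of_le_one_right (hWg0 i ω) (hA1 i ω)).trans (hWg1 i hi ω)
    have hPm : Measurable (P m) := (hPh m).mono (h.history_le m) le_rfl
    have iW : Integrable W μ := integrable_of_abs_le hWm fun ω => by
      rw [abs_of_nonneg (hW0 ω)]; exact hmax m hm ω
    have iWP : Integrable (fun ω => W ω * P m ω) μ := integrable_of_abs_le (hWm.mul hPm) fun ω => by
      rw [abs_of_nonneg (mul_nonneg (hW0 ω) (hP0 m ω))]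
      exact mul_le_mul (hmax m hm ω) (hPle m ω) (hP0 m ω) (by positivity)
    have e : ∀ ω, W ω * (Z (m + 1) ω - Z m ω) =
        q (m + 1) * (∑ i ∈ Finset.Ioc a m, W ω * g i ω * A i ω) +
          ((q (m + 1) - q m) * (W ω * P m ω) + (q (m + 1) - 1) * W ω) := by
      intro ω
      have e2 : P (m + 1) ω = P m ω + 1 + ∑ i ∈ Finset.Ioc a m, g i ω * A i ω :=
        goodPot_succ (fun m => v m ω) (GoodArrival (fun m => X m ω) δ t) k hm
      simp only [hZ]
      rw [e2]
      simp_rw [mul_assoc]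
      rw [← Finset.mul_sum]
      push_cast
      ring
    have hsum : ∑ i ∈ Finset.Ioc a m, ∫ ω, W ω * g i ω ∂μ = ∫ ω, W ω * P m ω ∂μ := by
      rw [← integral_finsetSum _ fun i hi => iWg i (Finset.mem_Ioc.mp hi).2]
      refine integral_congr_ae (ae_of_all _ fun ω => ?_)
      simp only [hP, hg, goodPot, Finset.mul_sum]
    -- The rate M/m is the same for all targets, so taking the weight `W` times 2^`goodDeg` for each
    -- target and summing reproduces the whole potential.
    have hrate : ∑ i ∈ Finset.Ioc a m, ∫ ω, W ω * g i ω * A i ω ∂μ ≤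
        M / m * ∫ ω, W ω * P m ω ∂μ := by
      rw [← hsum, Finset.mul_sum]
      refine Finset.sum_le_sum fun i hi => ?_
      have him := (Finset.mem_Ioc.mp hi).2
      exact h.integral_mul_goodChoice_le hs (by omega) him (hWgh i) (hWg0 i) (hWg1 i him)
        (hδ m hm) ht (hκ m hm hmn)
    change ∫ ω, W ω * (Z (m + 1) ω - Z m ω) ∂μ ≤ 0
    have iR : Integrable (fun ω =>
        (q (m + 1) - q m) * (W ω * P m ω) + (q (m + 1) - 1) * W ω) μ :=
      (iWP.const_mul _).add (iW.const_mul _)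
    simp_rw [e]
    rw [integral_add ((integrable_finsetSum _ fun i hi =>
        iWgA i (Finset.mem_Ioc.mp hi).2).const_mul _) iR,
      integral_add (iWP.const_mul _) (iW.const_mul _), integral_const_mul, integral_const_mul,
      integral_const_mul, integral_finsetSum _ fun i hi => iWgA i (Finset.mem_Ioc.mp hi).2]
    have hI1 : 0 ≤ ∫ ω, W ω * P m ω ∂μ :=
      integral_nonneg fun ω => mul_nonneg (hW0 ω) (hP0 m ω)
    have hI2 : 0 ≤ ∫ ω, W ω ∂μ := integral_nonneg hW0
    have h1 := mul_le_mul_of_nonneg_left hrate (hq0 (m + 1))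
    have h2 := mul_le_mul_of_nonneg_right (hqup m hm) hI1
    have h3 := mul_nonneg (sub_nonneg.mpr (hq1 (m + 1) (by omega))) hI2
    nlinarith

end IsGPA

end SecondMoment

/-! ### Combining the estimates into a linear bound with a √n remainder -/

section Remainder

variable {Ω : Type*} [mΩ : MeasurableSpace Ω] {μ : Measure Ω} [IsProbabilityMeasure μ] {d : ℕ}
  {f : EuclideanSpace ℝ (Fin d) → ℝ} {s : ℝ}
  {X : ℕ → Ω → EuclideanSpace ℝ (Fin d)} {v : ℕ → Ω → ℕ}

local notation "law" => volume.withDensity fun x => ENNReal.ofReal (f x)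

/-- The truncated kernel equals 1 on the punctured ball, so its mass bound also bounds the ball. -/
theorem measureReal_near_le {d : ℕ} (ν : Measure (EuclideanSpace ℝ (Fin d)))
    [IsFiniteMeasure ν] {s : ℝ} (hs : 0 < s) {δ B : ℝ} {x : EuclideanSpace ℝ (Fin d)}
    (hB : ∫ y, min 1 ((δ / dist x y) ^ s) ∂ν ≤ B) (hδ : 0 ≤ δ) :
    ν.real {y | Near δ x y} ≤ B := by
  have hm : MeasurableSet {y | Near δ x y} := measurableSet_near measurable_const measurable_id δ
  have h0 : ∀ y, 0 ≤ min 1 ((δ / dist x y) ^ s) := fun y => le_min zero_le_one (by positivity)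
  refine le_trans ?_ hB
  rw [← integral_indicator_one hm]
  refine integral_mono_of_nonneg (ae_of_all _ fun y => Set.indicator_nonneg (by simp) y)
    (integrable_of_abs_le (K := 1) (by fun_prop) fun y => ?_) (ae_of_all _ fun y => ?_)
  · rw [abs_of_nonneg (h0 y)]; exact min_le_left _ _
  · by_cases h : Near δ x y
    · rw [Set.indicator_of_mem (by exact h), Pi.one_apply]
      refine le_min le_rfl (Real.one_le_rpow ?_ hs.le)
      rw [le_div_iff₀ h.1, one_mul]
      exact h.2
    · rw [Set.indicator_of_notMem (by exact h)]
      exact h0 y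

theorem add_add_sq_le_three_mul (x y z : ℝ) : (x + y + z) ^ 2 ≤ 3 * (x ^ 2 + y ^ 2 + z ^ 2) := by
  nlinarith [sq_nonneg (x - y), sq_nonneg (x - z), sq_nonneg (y - z)]

/-- Pointwise bookkeeping: few bad arrivals and a small degree potential leave few vertices of large
degree. -/
theorem numDegGE_le_of_pot {v : ℕ → ℕ} (hv : ∀ j, 1 ≤ j → v j < j) {G : ℕ → Prop} {a n k M : ℕ}
    (ha : 1 ≤ a) (han : a ≤ n) (hk1 : 1 ≤ k) {t : ℝ} (ht : 0 < t)
    (hk : M * t + t ≤ (k - 1) * Real.log 2) (hat : Real.exp (-t) * n ≤ a) :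
    (numDegGE v n k : ℝ) ≤ (a + 1) + badCount G a n +
      (Real.exp (-t) * n + max (goodPot v G k a n * ((a : ℝ) / n) ^ M - (n - a)) 0) := by
  classical
  have h1 := numDegGE_le_add (a := a) (n := n) hv G hk1
  have h2 := card_goodDeg_le (v := v) (G := G) (k := k) a n
  set V := max (goodPot v G k a n * ((a : ℝ) / n) ^ M - (n - a)) 0 with hV
  set N := ((Finset.Ioc a n).filter fun i => k - 1 ≤ goodDeg v G k i n).card with hN
  have ha0 : (0 : ℝ) < a := by exact_mod_cast ha
  have hn0 : (0 : ℝ) < n := ha0.trans_le (by exact_mod_cast han)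
  have hV0 : 0 ≤ V := le_max_right _ _
  have h3 : goodPot v G k a n * ((a : ℝ) / n) ^ M ≤ n + V := by
    have := le_max_left (goodPot v G k a n * ((a : ℝ) / n) ^ M - (n - a)) 0
    rw [← hV] at this
    linarith
  have h4 : Real.exp (-(M * t)) ≤ ((a : ℝ) / n) ^ M := by
    rw [← mul_neg, Real.exp_nat_mul]
    gcongr
    rw [le_div_iff₀ hn0]
    exact hat
  have h5 : Real.exp (M * t + t) ≤ 2 ^ (k - 1) := by
    rw [← Real.rpow_natCast, Real.rpow_def_of_pos two_pos, Nat.cast_sub hk1, Nat.cast_one,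
      mul_comm (Real.log 2)]
    gcongr
  -- Undoing the discount costs e^(Mt); the factor 2^(k-1) pays for this and leaves e^t to spare.
  have h6 : (N : ℝ) * Real.exp t ≤ n + V := by
    calc (N : ℝ) * Real.exp t = N * Real.exp (M * t + t) * Real.exp (-(M * t)) := by
          rw [mul_assoc, ← Real.exp_add]; congr 2; ring
      _ ≤ N * 2 ^ (k - 1) * ((a : ℝ) / n) ^ M := by gcongr
      _ ≤ goodPot v G k a n * ((a : ℝ) / n) ^ M := by gcongr
      _ ≤ n + V := h3
  have h7 : (N : ℝ) ≤ Real.exp (-t) * n + V := by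
    have e : (N : ℝ) = Real.exp (-t) * (N * Real.exp t) := by
      rw [mul_left_comm, ← Real.exp_add]; simp
    rw [e]
    have hle1 : Real.exp (-t) ≤ 1 := Real.exp_le_one_iff.mpr (by linarith)
    have := mul_le_mul_of_nonneg_left h6 (Real.exp_pos (-t)).le
    nlinarith
  have h8 : (numDegGE v n k : ℝ) ≤ (a + 1) + badCount G a n + N := by exact_mod_cast h1
  linarith

namespace IsGPA

/-- The number of vertices of degree at least `k` is at most `4 e ^ (-t) n` up to a remainder of
order `√n` in mean square. -/
theorem exists_remainder (h : IsGPA μ f (fun r => r ^ (-s)) X v) (hd : 1 ≤ d) (hs : 0 < s)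
    {C c r₀ : ℝ} (hC0 : 0 < C) (hc0 : 0 < c) (hr₀ : 0 < r₀)
    (hC : ∀ (x : EuclideanSpace ℝ (Fin d)) (R : ℝ), 0 < R →
      ∫ y, min 1 ((R / dist x y) ^ s) ∂law ≤ C * R ^ d)
    (hc : ∀ᵐ y ∂law, ∀ r, 0 < r → r ≤ r₀ → c * r ^ d ≤ (law).real {x | Near r x y})
    {t : ℝ} (ht : 0 < t) {k M : ℕ} (hk1 : 1 ≤ k)
    (hM : C * (4 * t / c) * ((k : ℝ) / t) ^ ((d : ℝ) / s) ≤ M)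
    (hk : M * t + t ≤ (k - 1) * Real.log 2) :
    ∃ (K : ℝ) (n₀ : ℕ), ∀ n ≥ n₀, ∃ T : Ω → ℝ, Integrable T μ ∧ ∫ ω, T ω ∂μ ≤ K * n ∧
      ∀ ω, 0 ≤ T ω ∧ (numDegGE (fun m => v m ω) n k : ℝ) ≤ 4 * Real.exp (-t) * n + √(T ω) := by
  have hprob := h.isProbabilityMeasure_law
  set ε := Real.exp (-t) with hε
  have hε0 : 0 < ε := Real.exp_pos _
  have hε1 : ε ≤ 1 := Real.exp_le_one_iff.mpr (by linarith)
  -- With δ_m^d = A/m, the lower ball mass c δ_m^d equals 4t/m.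
  set A := 4 * t / c with hA
  have hA0 : 0 < A := by positivity
  -- Q/j dominates both the upper ball mass C A/j and the lower bound 4t/j.
  set Q := C * A + 4 * t with hQ
  have hQ0 : 0 < Q := by positivity
  set δ : ℕ → ℝ := fun m => (A / m) ^ ((d : ℝ)⁻¹) with hδdef
  -- In the threshold, 2 gives a + 1 ≤ 2εn, A/r₀^d gives δ_m ≤ r₀, and 4t gives 4t/m ≤ 1 for m ≥ a.
  refine ⟨3 * ((1 + Real.exp t) ^ 2 + (Real.exp t) ^ 2 * (Q ^ 2 / ε) +
    (2 + 2 ^ k + M * 2 ^ k) ^ 2), ⌈(2 + A / r₀ ^ d + 4 * t) / ε⌉₊, fun n hn => ?_⟩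
  have hn' : 2 + A / r₀ ^ d + 4 * t ≤ ε * n := by
    have := (Nat.le_ceil _).trans (Nat.cast_le (α := ℝ).mpr hn)
    rwa [div_le_iff₀' hε0] at this
  have hAr : 0 < A / r₀ ^ d := by positivity
  set a := ⌈ε * n⌉₊ with ha
  have hat : ε * n ≤ a := Nat.le_ceil _
  have hat' : (a : ℝ) < ε * n + 1 := Nat.ceil_lt_add_one (by positivity)
  have ha2 : (2 : ℝ) < a := by linarith
  have ha1 : 1 ≤ a := by
    have : (1 : ℝ) ≤ a := by linarith
    exact_mod_cast this
  have han : a ≤ n := by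
    rw [ha, Nat.ceil_le]
    exact mul_le_of_le_one_left (Nat.cast_nonneg n) hε1
  have hn0 : (0 : ℝ) < n := by
    have : 0 < n := by omega
    exact_mod_cast this
  have hm0 : ∀ m, a ≤ m → (0 : ℝ) < m := fun m hm => by
    have : 0 < m := by omega
    exact_mod_cast this
  have hma : ∀ m, a ≤ m → ε * n ≤ m := fun m hm => hat.trans (by exact_mod_cast hm)
  have hδ0 : ∀ m, a ≤ m → 0 < δ m := fun m hm => by
    have := hm0 m hm
    simp only [hδdef]; positivity
  have hδd : ∀ m, a ≤ m → δ m ^ d = A / m := fun m hm => by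
    have := hm0 m hm
    exact Real.rpow_inv_natCast_pow (by positivity) (by omega)
  have hδr : ∀ m, a ≤ m → δ m ≤ r₀ := fun m hm => by
    have h1 := hm0 m hm
    have h2 : A / m ≤ r₀ ^ d := by
      rw [div_le_iff₀ h1, ← div_le_iff₀' (by positivity)]
      have := hma m hm
      linarith
    calc δ m ≤ (r₀ ^ d) ^ ((d : ℝ)⁻¹) := Real.rpow_le_rpow (by positivity) h2 (by positivity)
      _ = r₀ := Real.pow_rpow_inv_natCast hr₀.le (by omega)
  obtain ⟨iP, bP⟩ := h.integral_goodPot_sq_le (δ := δ) (t := t) (k := k) (M := M) hs ht ha1 han hδ0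
    fun m hm _ x => by
      have h1 := hm0 m hm
      have hkt : (0 : ℝ) < k / t := by
        have : (0 : ℝ) < k := by exact_mod_cast hk1
        positivity
      refine (hC x _ (mul_pos (hδ0 m hm) (by positivity))).trans ?_
      rw [mul_pow, hδd m hm, ← Real.rpow_natCast ((k / t) ^ (1 / s)), ← Real.rpow_mul hkt.le,
        one_div_mul_eq_div]
      calc C * (A / m * (k / t) ^ ((d : ℝ) / s)) = C * A * (k / t) ^ ((d : ℝ) / s) / m := by ring
        _ ≤ M / m := by gcongr
  obtain ⟨iB, bB⟩ := h.integral_badCount_sq_le δ t han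
  -- Each j has its own supermartingale: the scale δ_j is held fixed while the points 1, …, j are
  -- added.
  set U : ℕ → Ω → ℝ := fun j ω =>
    max (nearPot law (fun m => X m ω) (δ j) j - (1 - 4 * t / j / 2) ^ j) 0 with hU
  have hUj : ∀ j ∈ Finset.Ico a n, Integrable (fun ω => U j ω ^ 2) μ ∧
      ∫ ω, U j ω ^ 2 ∂μ ≤ Q ^ 2 / (ε * n) := by
    intro j hj
    have hja := (Finset.mem_Ico.mp hj).1
    have hj0 := hm0 j hja
    obtain ⟨i1, b1⟩ := h.integral_nearPot_sq_le (δ := δ j) (p := 4 * t / j) (q := Q / j)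
      (by positivity) (by gcongr; simp only [hQ]; nlinarith [mul_pos hC0 hA0])
      (by rw [div_le_one hj0]; have := hma j hja; linarith)
      (by
        filter_upwards [hc] with y hy
        refine le_trans (le_of_eq ?_) (hy (δ j) (hδ0 j hja) (hδr j hja))
        rw [hδd j hja, hA]
        field_simp)
      (fun x => by
        refine measureReal_near_le law hs (le_trans (hC x _ (hδ0 j hja)) ?_) (hδ0 j hja).le
        rw [hδd j hja, mul_div_assoc']
        gcongr
        simp only [hQ]; linarith) j
    refine ⟨i1, b1.trans ?_⟩
    calc (j : ℝ) * (Q / j) ^ 2 = Q ^ 2 / j := by field_simp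
      _ ≤ Q ^ 2 / (ε * n) := by gcongr; exact hma j hja
  set VP : Ω → ℝ := fun ω => max (goodPot (fun m => v m ω) (GoodArrival (fun m => X m ω) δ t) k a n *
      ((a : ℝ) / n) ^ M - (n - a)) 0 with hVP
  set VB : Ω → ℝ := fun ω => max (badCount (GoodArrival (fun m => X m ω) δ t) a n -
      ∑ j ∈ Finset.Ico a n, Real.exp t * nearPot law (fun m => X m ω) (δ j) j) 0 with hVB
  have iU : Integrable (fun ω => ∑ j ∈ Finset.Ico a n, U j ω ^ 2) μ :=
    integrable_finsetSum _ fun j hj => (hUj j hj).1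
  have bU : ∫ ω, ∑ j ∈ Finset.Ico a n, U j ω ^ 2 ∂μ ≤ Q ^ 2 / ε := by
    rw [integral_finsetSum _ fun j hj => (hUj j hj).1]
    refine (Finset.sum_le_card_nsmul _ _ _ fun j hj => (hUj j hj).2).trans ?_
    rw [nsmul_eq_mul, Nat.card_Ico]
    calc ((n - a : ℕ) : ℝ) * (Q ^ 2 / (ε * n)) ≤ n * (Q ^ 2 / (ε * n)) := by
          gcongr; exact Nat.sub_le _ _
      _ = Q ^ 2 / ε := by field_simp
  have iBU : Integrable (fun ω => VB ω ^ 2 +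
      (Real.exp t) ^ 2 * n * ∑ j ∈ Finset.Ico a n, U j ω ^ 2) μ := iB.add (iU.const_mul _)
  have hna : (n : ℝ) - a ≤ n := by linarith
  refine ⟨fun ω => 3 * ((VB ω ^ 2 + (Real.exp t) ^ 2 * n * ∑ j ∈ Finset.Ico a n, U j ω ^ 2) +
    VP ω ^ 2), (iBU.add iP).const_mul 3, ?_, fun ω => ⟨?_, ?_⟩⟩
  · rw [integral_const_mul, integral_add iBU iP, integral_add iB (iU.const_mul _),
      integral_const_mul]
    have h1 : ∫ ω, VB ω ^ 2 ∂μ ≤ n * (1 + Real.exp t) ^ 2 := bB.trans (by gcongr)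
    have h2 : ∫ ω, VP ω ^ 2 ∂μ ≤ n * (2 + 2 ^ k + M * 2 ^ k) ^ 2 := bP.trans (by gcongr)
    have h3 := mul_le_mul_of_nonneg_left bU (show 0 ≤ (Real.exp t) ^ 2 * n by positivity)
    linarith
  · have : 0 ≤ ∑ j ∈ Finset.Ico a n, U j ω ^ 2 := Finset.sum_nonneg fun j _ => by positivity
    positivity
  · have h1 := numDegGE_le_of_pot (v := fun m => v m ω) (G := GoodArrival (fun m => X m ω) δ t)
      (h.choice_lt ω) ha1 han hk1 ht hk hat
    have h2 : (badCount (GoodArrival (fun m => X m ω) δ t) a n : ℝ) ≤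
        (∑ j ∈ Finset.Ico a n, Real.exp t * nearPot law (fun m => X m ω) (δ j) j) + VB ω := by
      have := le_max_left ((badCount (GoodArrival (fun m => X m ω) δ t) a n : ℝ) -
        ∑ j ∈ Finset.Ico a n, Real.exp t * nearPot law (fun m => X m ω) (δ j) j) 0
      simp only [hVB]
      linarith
    have h3 : ∀ j ∈ Finset.Ico a n,
        Real.exp t * nearPot law (fun m => X m ω) (δ j) j ≤ ε + Real.exp t * U j ω := by
      intro j hj
      have hja := (Finset.mem_Ico.mp hj).1
      have hj0 := hm0 j hja
      -- The 4 in `A` is chosen for this: the Chernoff factor e^t uses up half of the exponent 2t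
      -- and leaves ε.
      have e1 : (1 - 4 * t / j / 2) ^ j ≤ Real.exp (-(2 * t)) := by
        have hnn : 0 ≤ 1 - 4 * t / j / 2 := by
          have : 4 * t / j ≤ 1 := by rw [div_le_one hj0]; have := hma j hja; linarith
          linarith
        calc (1 - 4 * t / j / 2) ^ j ≤ Real.exp (-(4 * t / j / 2)) ^ j :=
              pow_le_pow_left₀ hnn (Real.one_sub_le_exp_neg _) j
          _ = Real.exp (-(2 * t)) := by
              rw [← Real.exp_nat_mul]; congr 1; field_simp; ring
      have e2 := le_max_left (nearPot law (fun m => X m ω) (δ j) j - (1 - 4 * t / j / 2) ^ j) 0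
      have e3 : nearPot law (fun m => X m ω) (δ j) j ≤ Real.exp (-(2 * t)) + U j ω := by
        simp only [hU]; linarith
      calc _ ≤ Real.exp t * (Real.exp (-(2 * t)) + U j ω) := by gcongr
        _ = ε + Real.exp t * U j ω := by
            rw [mul_add, ← Real.exp_add, hε]; congr 2; ring
    have h4 : (∑ j ∈ Finset.Ico a n, Real.exp t * nearPot law (fun m => X m ω) (δ j) j) ≤
        ε * n + Real.exp t * ∑ j ∈ Finset.Ico a n, U j ω := by
      refine (Finset.sum_le_sum h3).trans ?_
      rw [Finset.sum_add_distrib, ← Finset.mul_sum, Finset.sum_const, nsmul_eq_mul, Nat.card_Ico,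
        mul_comm]
      gcongr
      exact Nat.sub_le _ _
    -- Of the four εn, two cover a + 1, one the bad arrivals and one the degree potential.
    have h5 : (numDegGE (fun m => v m ω) n k : ℝ) ≤ 4 * ε * n +
        (VB ω + Real.exp t * (∑ j ∈ Finset.Ico a n, U j ω) + VP ω) := by
      simp only [hVP]
      linarith
    refine h5.trans (add_le_add le_rfl (Real.le_sqrt_of_sq_le ?_))
    dsimp only
    -- Cauchy–Schwarz loses a factor n, affordable because the sum of squares has mean at most Q²/ε.
    have h6 : (∑ j ∈ Finset.Ico a n, U j ω) ^ 2 ≤ n * ∑ j ∈ Finset.Ico a n, U j ω ^ 2 := by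
      refine sq_sum_le_card_mul_sum_sq.trans ?_
      rw [Nat.card_Ico]
      have : 0 ≤ ∑ j ∈ Finset.Ico a n, U j ω ^ 2 := Finset.sum_nonneg fun j _ => by positivity
      gcongr
      exact Nat.sub_le _ _
    have h7 := mul_le_mul_of_nonneg_left h6 (show 0 ≤ (Real.exp t) ^ 2 by positivity)
    rw [← mul_pow] at h7
    rw [← mul_assoc] at h7
    refine (add_add_sq_le_three_mul _ _ _).trans ?_
    gcongr

end IsGPA

end Remainder

/-! ### Choice of exponents, almost sure and mean bounds, main theorem -/

section Conclusion

open Filter in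
theorem eventually_rpow_le_mul {e η : ℝ} (he : e < 1) (hη : 0 < η) :
    ∀ᶠ x : ℝ in atTop, x ^ e ≤ η * x := by
  have h := (tendsto_rpow_neg_atTop (sub_pos.mpr he)).eventually (eventually_le_nhds hη)
  filter_upwards [h, eventually_gt_atTop 0] with x hx hx0
  calc x ^ e = x ^ (-(1 - e)) * x := by
        rw [← Real.rpow_add_one hx0.ne']; congr 1; ring
    _ ≤ η * x := by gcongr

/-- The choice of exponents: with `t = k ^ γ` the attachment rate times `t` is negligible against
`k`. -/
theorem exists_rate (d : ℕ) {s γ D : ℝ} (hs : (d : ℝ) < s) (hγ0 : 0 < γ)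
    (hγ : γ < (s - d) / (2 * s - d)) (hD : 0 ≤ D) :
    ∃ k₀ : ℕ, 1 ≤ k₀ ∧ ∀ k : ℕ, k₀ ≤ k → ∃ M : ℕ,
      D * (k : ℝ) ^ γ * ((k : ℝ) / (k : ℝ) ^ γ) ^ ((d : ℝ) / s) ≤ M ∧
      M * (k : ℝ) ^ γ + (k : ℝ) ^ γ ≤ ((k : ℝ) - 1) * Real.log 2 := by
  have hd0 : (0 : ℝ) ≤ d := Nat.cast_nonneg d
  have hs0 : 0 < s := hd0.trans_lt hs
  have h2s : 0 < 2 * s - d := by linarith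
  have hγ' : γ * (2 * s - d) < s - d := (lt_div_iff₀ h2s).mp hγ
  have hγ1 : γ < 1 := by
    refine hγ.trans ((div_lt_one h2s).mpr (by linarith))
  -- The exponent of k in t² (k/t)^(d/s) for t = k^γ; it is below 1 by the upper bound on γ.
  set e := 2 * γ + (1 - γ) * (d / s) with he
  have he1 : e < 1 := by
    have : e = (γ * (2 * s - d) + d) / s := by rw [he]; field_simp; ring
    rw [this, div_lt_one hs0]
    linarith
  have hlog : 0 < Real.log 2 := Real.log_pos one_lt_two
  -- The budget k log 2 is split among D k^e, two copies of k^γ (one from rounding M up) and the log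
  -- 2 lost in k - 1.
  set η := Real.log 2 / (D + 2 + Real.log 2) with hη
  have hη0 : 0 < η := by positivity
  have hev := ((eventually_rpow_le_mul he1 hη0).and ((eventually_rpow_le_mul hγ1 hη0).and
    (eventually_rpow_le_mul zero_lt_one hη0)))
  obtain ⟨k₀, hk₀⟩ := Filter.eventually_atTop.mp
    (tendsto_natCast_atTop_atTop.eventually hev)
  refine ⟨max k₀ 1, le_max_right _ _, fun k hk => ?_⟩
  obtain ⟨h1, h2, h3⟩ := hk₀ k (le_of_max_le_left hk)
  have hk1 : (1 : ℝ) ≤ k := by exact_mod_cast le_of_max_le_right hk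
  have hk0 : (0 : ℝ) < k := by linarith
  refine ⟨⌈D * (k : ℝ) ^ γ * ((k : ℝ) / (k : ℝ) ^ γ) ^ ((d : ℝ) / s)⌉₊, Nat.le_ceil _, ?_⟩
  have hlt := Nat.ceil_lt_add_one
    (show 0 ≤ D * (k : ℝ) ^ γ * ((k : ℝ) / (k : ℝ) ^ γ) ^ ((d : ℝ) / s) by positivity)
  have ht0 : 0 < (k : ℝ) ^ γ := by positivity
  have e1 : D * (k : ℝ) ^ γ * ((k : ℝ) / (k : ℝ) ^ γ) ^ ((d : ℝ) / s) * (k : ℝ) ^ γ =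
      D * (k : ℝ) ^ e := by
    have : (k : ℝ) / (k : ℝ) ^ γ = (k : ℝ) ^ (1 - γ) := by
      rw [Real.rpow_sub hk0, Real.rpow_one]
    rw [this, ← Real.rpow_mul hk0.le, he, Real.rpow_add hk0, two_mul, Real.rpow_add hk0]
    ring
  have h4 := mul_lt_mul_of_pos_right hlt ht0
  rw [add_mul, e1] at h4
  have h5 := mul_le_mul_of_nonneg_left h1 hD
  have h6 : (D + 2 + Real.log 2) * η = Real.log 2 := by rw [hη]; field_simp
  rw [Real.rpow_zero] at h3
  have h7 := mul_le_mul_of_nonneg_left h3 hlog.le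
  have h8 : D * (η * k) + 2 * (η * k) + Real.log 2 * (η * k) = Real.log 2 * k := by
    calc _ = (D + 2 + Real.log 2) * η * k := by ring
      _ = Real.log 2 * k := by rw [h6]
  linarith

variable {Ω : Type*} [mΩ : MeasurableSpace Ω] {μ : Measure Ω} [IsProbabilityMeasure μ]

/-- Concentration at scale `√n` along powers of two and monotonicity give an almost sure bound. -/
theorem ae_eventually_numDegGE_le {v : ℕ → Ω → ℕ} {k : ℕ} {ε K : ℝ} {n₀ : ℕ} (hε : 0 < ε)
    (hT : ∀ n ≥ n₀, ∃ T : Ω → ℝ, Integrable T μ ∧ ∫ ω, T ω ∂μ ≤ K * n ∧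
      ∀ ω, 0 ≤ T ω ∧ (numDegGE (fun m => v m ω) n k : ℝ) ≤ 4 * ε * n + √(T ω)) :
    ∀ᵐ ω ∂μ, ∀ᶠ n : ℕ in Filter.atTop,
      (n : ℝ)⁻¹ * (numDegGE (fun m => v m ω) n k : ℝ) ≤ 10 * ε := by
  -- The shift by n₀ ensures that every power used is at least n₀.
  set A : ℕ → Set Ω := fun J =>
    {ω | 5 * ε * (2 ^ (J + n₀) : ℕ) < (numDegGE (fun m => v m ω) (2 ^ (J + n₀)) k : ℝ)} with hA
  have hbound : ∀ J, μ (A J) ≤ ENNReal.ofReal (K / ε ^ 2 / 2 ^ n₀ * (1 / 2) ^ J) := by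
    intro J
    set n := 2 ^ (J + n₀) with hn
    have hn0 : (0 : ℝ) < n := by rw [hn]; positivity
    obtain ⟨T, hTi, hTb, hTn⟩ := hT n
      ((Nat.lt_two_pow_self).le.trans (Nat.pow_le_pow_right two_pos (Nat.le_add_left n₀ J)))
    have hsub : A J ⊆ {ω | (ε * n) ^ 2 ≤ T ω} := by
      intro ω hω
      have h1 : 5 * ε * n < (numDegGE (fun m => v m ω) n k : ℝ) := hω
      have h2 : ε * n ≤ √(T ω) := by
        have := (hTn ω).2
        linarith
      calc (ε * n) ^ 2 ≤ √(T ω) ^ 2 := by gcongr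
        _ = T ω := Real.sq_sqrt (hTn ω).1
    have hmarkov := mul_meas_ge_le_integral_of_nonneg (ae_of_all μ fun ω => (hTn ω).1) hTi
      ((ε * n) ^ 2)
    refine (measure_mono hsub).trans ?_
    rw [← ofReal_measureReal]
    refine ENNReal.ofReal_le_ofReal ?_
    have h3 : μ.real {ω | (ε * n) ^ 2 ≤ T ω} ≤ K * n / (ε * n) ^ 2 := by
      rw [le_div_iff₀' (by positivity)]
      exact hmarkov.trans hTb
    refine h3.trans (le_of_eq ?_)
    have h4 : (n : ℝ) = 2 ^ J * 2 ^ n₀ := by rw [hn]; push_cast; exact pow_add _ _ _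
    rw [one_div, inv_pow]
    rw [h4]
    field_simp
  have hsum : ∑' J, μ (A J) ≠ ⊤ := by
    refine ne_top_of_le_ne_top ?_ (ENNReal.tsum_le_tsum hbound)
    exact (summable_geometric_two.mul_left _).tsum_ofReal_ne_top
  filter_upwards [ae_eventually_notMem hsum] with ω hω
  obtain ⟨J₁, hJ₁⟩ := Filter.eventually_atTop.mp hω
  filter_upwards [Filter.eventually_ge_atTop (2 ^ (J₁ + n₀))] with n hn
  have hnpos : 0 < n := (Nat.two_pow_pos _).trans_le hn
  set L := Nat.log 2 n with hL
  have hL1 : J₁ + n₀ ≤ L := by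
    rw [hL]; exact (Nat.le_log_iff_pow_le one_lt_two hnpos.ne').mpr hn
  have hlow : 2 ^ L ≤ n := Nat.pow_log_le_self 2 hnpos.ne'
  have hup : n ≤ 2 ^ (L + 1) := (Nat.lt_pow_succ_log_self one_lt_two n).le
  -- This selects the power 2^(L+1), which is at least n and at most 2n, whence 5ε becomes 10ε.
  have hnot := hJ₁ (L + 1 - n₀) (by omega)
  have hle : (numDegGE (fun m => v m ω) (2 ^ (L + 1)) k : ℝ) ≤ 5 * ε * (2 ^ (L + 1) : ℕ) := by
    have h1 : ¬ 5 * ε * (2 ^ (L + 1 - n₀ + n₀) : ℕ) <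
      (numDegGE (fun m => v m ω) (2 ^ (L + 1 - n₀ + n₀)) k : ℝ) := hnot
    rw [Nat.sub_add_cancel (by omega)] at h1
    exact not_lt.mp h1
  have hmono : (numDegGE (fun m => v m ω) n k : ℝ) ≤
      numDegGE (fun m => v m ω) (2 ^ (L + 1)) k := by
    exact_mod_cast numDegGE_mono (fun m => v m ω) k hup
  have hn0 : (0 : ℝ) < n := by exact_mod_cast hnpos
  rw [inv_mul_le_iff₀ hn0]
  have hlow' : (2 : ℝ) ^ L ≤ n := by exact_mod_cast hlow
  calc (numDegGE (fun m => v m ω) n k : ℝ) ≤ 5 * ε * (2 ^ (L + 1) : ℕ) := hmono.trans hle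
    _ = 10 * ε * 2 ^ L := by push_cast; ring
    _ ≤ 10 * ε * n := by gcongr
    _ = n * (10 * ε) := mul_comm _ _

/-- Linearise the root by √T ≤ εn + T/(εn); the last term has mean at most K/ε, negligible against
n. -/
theorem eventually_integral_numDegGE_le {v : ℕ → Ω → ℕ} {k : ℕ} {ε K : ℝ} {n₀ : ℕ} (hε : 0 < ε)
    (hT : ∀ n ≥ n₀, ∃ T : Ω → ℝ, Integrable T μ ∧ ∫ ω, T ω ∂μ ≤ K * n ∧
      ∀ ω, 0 ≤ T ω ∧ (numDegGE (fun m => v m ω) n k : ℝ) ≤ 4 * ε * n + √(T ω)) :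
    ∀ᶠ n : ℕ in Filter.atTop,
      (n : ℝ)⁻¹ * ∫ ω, (numDegGE (fun m => v m ω) n k : ℝ) ∂μ ≤ 10 * ε := by
  filter_upwards [Filter.eventually_ge_atTop n₀, Filter.eventually_ge_atTop 1,
    Filter.eventually_ge_atTop ⌈K / ε ^ 2⌉₊] with n hn hn1 hnK
  have hn0 : (0 : ℝ) < n := by exact_mod_cast hn1
  obtain ⟨T, hTi, hTb, hTn⟩ := hT n hn
  have hK : K ≤ ε ^ 2 * n := by
    have := (Nat.le_ceil _).trans (Nat.cast_le (α := ℝ).mpr hnK)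
    rwa [div_le_iff₀' (by positivity)] at this
  have hεn : 0 < ε * n := by positivity
  rw [inv_mul_le_iff₀ hn0]
  calc ∫ ω, (numDegGE (fun m => v m ω) n k : ℝ) ∂μ ≤ ∫ ω, (5 * ε * n + (ε * n)⁻¹ * T ω) ∂μ := by
        refine integral_mono_of_nonneg (ae_of_all _ fun ω => Nat.cast_nonneg _)
          ((integrable_const _).add (hTi.const_mul _)) (ae_of_all _ fun ω => ?_)
        obtain ⟨h0, h1⟩ := hTn ω
        have h2 : √(T ω) ≤ ε * n + (ε * n)⁻¹ * T ω := by
          have h3 := Real.sq_sqrt h0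
          have h4 : 0 ≤ (ε * n)⁻¹ * (√(T ω) - ε * n) ^ 2 := by positivity
          have h5 : (ε * n)⁻¹ * (√(T ω) - ε * n) ^ 2 =
              (ε * n)⁻¹ * T ω - 2 * √(T ω) + ε * n := by
            rw [← h3, Real.sqrt_sq (Real.sqrt_nonneg _)]; field_simp; ring
          have := Real.sqrt_nonneg (T ω)
          linarith
        dsimp only
        linarith
    _ = 5 * ε * n + (ε * n)⁻¹ * ∫ ω, T ω ∂μ := by
        rw [integral_add (integrable_const _) (hTi.const_mul _), integral_const, integral_const_mul,
          probReal_univ, one_smul]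
    _ ≤ 5 * ε * n + (ε * n)⁻¹ * (ε ^ 2 * n * n) := by
        gcongr
        exact hTb.trans (by gcongr)
    _ ≤ n * (10 * ε) := by
        have : (ε * n)⁻¹ * (ε ^ 2 * n * n) = ε * n := by field_simp
        rw [this]
        linarith

theorem inv_mul_numDegGE_le_two (v : ℕ → ℕ) (k : ℕ) {n : ℕ} (hn : 1 ≤ n) :
    (n : ℝ)⁻¹ * (numDegGE v n k : ℝ) ≤ 2 := by
  have hn1 : (1 : ℝ) ≤ n := by exact_mod_cast hn
  rw [inv_mul_le_iff₀ (by linarith)]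
  have : (numDegGE v n k : ℝ) ≤ n + 1 := by exact_mod_cast numDegGE_le v n k
  linarith

/-- Nonnegativity supplies the coboundedness that a real-valued `limsup` requires. -/
theorem limsup_le_of_eventually_le {u : ℕ → ℝ} {c : ℝ} (h0 : ∀ n, 0 ≤ u n)
    (h : ∀ᶠ n in Filter.atTop, u n ≤ c) : Filter.limsup u Filter.atTop ≤ c := by
  refine Filter.limsup_le_of_le ?_ h
  exact Filter.IsBoundedUnder.isCoboundedUnder_le ⟨0, Filter.eventually_map.mpr
    (Filter.Eventually.of_forall h0)⟩

end Conclusion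

theorem theorem4 (d : ℕ) (hd : 1 ≤ d) (S : Set (EuclideanSpace ℝ (Fin d)))
    (hScompact : IsCompact S) (hSconvex : Convex ℝ S) (hSvol : 0 < volume S)
    (f : EuclideanSpace ℝ (Fin d) → ℝ) (hfmeas : Measurable f)
    (hfsupp : ∀ x, x ∉ S → f x = 0) (hfint : ∫ x, f x = 1)
    (hfbdd : ∃ a b : ℝ, 0 < a ∧ ∀ x ∈ S, a ≤ f x ∧ f x ≤ b)
    (s : ℝ) (hs : (d : ℝ) < s)
    (γ : ℝ) (hγ : γ ∈ Set.Ioo (0 : ℝ) ((s - d) / (2 * s - d))) :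
    ∃ C : ℝ, ∀ (Ω : Type*) [MeasurableSpace Ω] (μ : Measure Ω) [IsProbabilityMeasure μ]
      (X : ℕ → Ω → EuclideanSpace ℝ (Fin d)) (v : ℕ → Ω → ℕ),
      IsGPA μ f (fun r => r ^ (-s)) X v →
      ∀ k : ℕ,
        (∀ᵐ ω ∂μ,
          Filter.limsup (fun n : ℕ => (n : ℝ)⁻¹ * (numDegGE (fun m => v m ω) n k : ℝ))
            Filter.atTop ≤ C * Real.exp (-((k : ℝ) ^ γ))) ∧
        Filter.limsup (fun n : ℕ => (n : ℝ)⁻¹ * ∫ ω, (numDegGE (fun m => v m ω) n k : ℝ) ∂μ)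
            Filter.atTop ≤ C * Real.exp (-((k : ℝ) ^ γ)) := by
  obtain ⟨a, b, ha, hab⟩ := hfbdd
  have hs0 : 0 < s := (Nat.cast_nonneg d).trans_lt hs
  have hf0 : ∀ x, 0 ≤ f x := fun x => by
    by_cases hx : x ∈ S
    · exact ha.le.trans (hab x hx).1
    · exact (hfsupp x hx).ge
  have hfb : ∀ x, f x ≤ max b 0 := fun x => by
    by_cases hx : x ∈ S
    · exact (hab x hx).2.trans (le_max_left _ _)
    · rw [hfsupp x hx]; exact le_max_right _ _
  have hfinite := isFiniteMeasure_withDensity_ofReal (integrable_of_integral_eq_one hfint).2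
  obtain ⟨C, hC0, hC⟩ := exists_integral_min_rpow_le d hfmeas hf0 hfb hs
  obtain ⟨c, r₀, hc0, hr₀, hc⟩ :=
    exists_le_measure_near d hd hScompact hSconvex hSvol ha fun x hx => (hab x hx).1
  -- The lower mass bound is available only at centres in `S`, which carries the law.
  have hSae : ∀ᵐ y ∂(volume.withDensity fun x => ENNReal.ofReal (f x)), y ∈ S := by
    rw [ae_withDensity_iff hfmeas.ennreal_ofReal]
    refine ae_of_all _ fun y hy => ?_
    by_contra hyS
    exact hy (by rw [hfsupp y hyS, ENNReal.ofReal_zero])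
  obtain ⟨k₀, hk₀1, hk₀⟩ := exists_rate d (D := C * (4 / c)) hs hγ.1 hγ.2 (by positivity)
  -- The 10 serves k ≥ k₀; below k₀ the trivial bound n + 1 ≤ 2n suffices.
  refine ⟨max 10 (2 * Real.exp ((k₀ : ℝ) ^ γ)), fun Ω _ μ _ X v h k => ?_⟩
  have hexp : 0 < Real.exp (-((k : ℝ) ^ γ)) := Real.exp_pos _
  have hnonneg : ∀ ω (n : ℕ), 0 ≤ (n : ℝ)⁻¹ * (numDegGE (fun m => v m ω) n k : ℝ) :=
    fun ω n => by positivity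
  have hnonneg' : ∀ n : ℕ, 0 ≤ (n : ℝ)⁻¹ * ∫ ω, (numDegGE (fun m => v m ω) n k : ℝ) ∂μ :=
    fun n => mul_nonneg (by positivity) (integral_nonneg fun ω => Nat.cast_nonneg _)
  rcases lt_or_ge k k₀ with hlt | hge
  · have h2 : 2 ≤ max 10 (2 * Real.exp ((k₀ : ℝ) ^ γ)) * Real.exp (-((k : ℝ) ^ γ)) := by
      have hpow : (k : ℝ) ^ γ ≤ (k₀ : ℝ) ^ γ :=
        Real.rpow_le_rpow (Nat.cast_nonneg k) (by exact_mod_cast hlt.le) hγ.1.le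
      calc (2 : ℝ) ≤ 2 * Real.exp ((k₀ : ℝ) ^ γ - (k : ℝ) ^ γ) := by
            have := Real.one_le_exp (sub_nonneg.mpr hpow)
            linarith
        _ = 2 * Real.exp ((k₀ : ℝ) ^ γ) * Real.exp (-((k : ℝ) ^ γ)) := by
            rw [mul_assoc, ← Real.exp_add, sub_eq_add_neg]
        _ ≤ _ := by gcongr; exact le_max_right _ _
    refine ⟨ae_of_all _ fun ω => ?_, ?_⟩
    · refine limsup_le_of_eventually_le (hnonneg ω) ?_
      filter_upwards [Filter.eventually_ge_atTop 1] with n hn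
      exact (inv_mul_numDegGE_le_two _ k hn).trans h2
    · refine limsup_le_of_eventually_le hnonneg' ?_
      filter_upwards [Filter.eventually_ge_atTop 1] with n hn
      refine le_trans ?_ h2
      rw [← integral_const_mul]
      refine (integral_mono_of_nonneg (ae_of_all _ fun ω => hnonneg ω n) (integrable_const 2)
        (ae_of_all _ fun ω => inv_mul_numDegGE_le_two _ k hn)).trans (by simp)
  · have hk1 : 1 ≤ k := hk₀1.trans hge
    have ht : 0 < (k : ℝ) ^ γ := by
      have : (0 : ℝ) < k := by exact_mod_cast hk1
      positivity
    obtain ⟨M, hM1, hM2⟩ := hk₀ k hge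
    obtain ⟨K, n₀, hT⟩ := h.exists_remainder hd hs0 hC0 hc0 hr₀ hC
      (by filter_upwards [hSae] with y hy using hc y hy) ht hk1
      (le_trans (le_of_eq (by ring)) hM1) hM2
    have h10 : 10 * Real.exp (-((k : ℝ) ^ γ)) ≤
        max 10 (2 * Real.exp ((k₀ : ℝ) ^ γ)) * Real.exp (-((k : ℝ) ^ γ)) := by
      gcongr; exact le_max_left _ _
    refine ⟨?_, ?_⟩
    · filter_upwards [ae_eventually_numDegGE_le hexp hT] with ω hω
      exact (limsup_le_of_eventually_le (hnonneg ω) hω).trans h10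
    · exact (limsup_le_of_eventually_le hnonneg' (eventually_integral_numDegGE_le hexp hT)).trans h10
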